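/- Let $K$ be a field, $S=K[x_1,\ldots,x_5]$, and let $I\subseteq S$ be a squarefree monomial ideal, i.e. an ideal generated by squarefree monomials. A Stanley decomposition of $I$ is a presentation of $I$ as a finite direct sum of $K$-vector spaces $I=\bigoplus_{i=1}^r u_iK[Z_i]$, where each $u_i\in I$ is a nonzero element homogeneous for the $\mathbb{Z}^5$-grading (a nonzero scalar multiple of a monomial), $Z_i\subseteq\{x_1,\ldots,x_5\}$ and $u_iK[Z_i]=\{u_if : f\in K[Z_i]\}$. Its Stanley depth is $\min_i|Z_i|$, and $\operatorname{sdepth}_S I$ is the maximum of these numbers over all Stanley decompositions of $I$ (so $\operatorname{sdepth}_S 0=\infty$). For a finitely generated graded $S$-module $M\neq 0$ let $\operatorname{depth}_S M$ be the maximal length of an $M$-regular sequence in the ideal $(x_1,\ldots,x_5)$, and put $\operatorname{depth}_S 0=\infty$. Then $$\operatorname{sdepth}_S I\ \geq\ \operatorname{depth}_S I,$$ and, if $I\neq S$, equivalently $$\operatorname{sdepth}_S I\ \geq\ 1+\operatorname{depth}_S S/I .$$ -/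

import Mathlib

namespace StanleyDepth

variable {σ K : Type*} [Field K]

/-- A squarefree monomial ideal of the polynomial ring `S = K[x_i : i ∈ σ]`: an ideal generated by
squarefree monomials, that is, by products of pairwise distinct variables. -/
def IsSquarefreeMonomialIdeal (I : Ideal (MvPolynomial σ K)) : Prop :=
  ∃ G : Set (Finset σ),
    I = Ideal.span ((fun s : Finset σ => ∏ i ∈ s, (MvPolynomial.X i : MvPolynomial σ K)) '' G)

/-- The `K`-subspace `u K[Z] = {u f : f ∈ K[Z]}` of `S`, for `u ∈ S` and a set `Z` of variables. -/
noncomputable def stanleySpace (u : MvPolynomial σ K) (Z : Finset σ) :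
    Submodule K (MvPolynomial σ K) :=
  (Subalgebra.toSubmodule (MvPolynomial.supported K (Z : Set σ))).map (LinearMap.mulLeft K u)

/-- A Stanley decomposition of the ideal `I`: a presentation of the `K`-vector space `I` as a
finite (internal) direct sum of Stanley spaces `u_i K[Z_i]`, with `u_i ∈ I` homogeneous for the
multigrading. Since `S` is a domain, `u_i K[Z_i]` is free over `K[Z_i]` with basis `u_i` as soon
as `u_i ≠ 0`. -/
structure StanleyDecomposition (I : Ideal (MvPolynomial σ K)) where
  /-- The number of summands. -/
  r : ℕ
  /-- The homogeneous elements. -/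
  u : Fin r → MvPolynomial σ K
  /-- The sets of variables. -/
  Z : Fin r → Finset σ
  mem : ∀ i, u i ∈ I
  homogeneous : ∀ i, ∃ (a : σ →₀ ℕ) (c : K), u i = MvPolynomial.monomial a c
  ne_zero : ∀ i, u i ≠ 0
  independent : iSupIndep fun i => stanleySpace (u i) (Z i)
  iSup_eq : ⨆ i, stanleySpace (u i) (Z i) = Submodule.restrictScalars K I

/-- The Stanley depth `min |Z_i|` of a Stanley decomposition (`∞` if there are no summands). -/
noncomputable def StanleyDecomposition.sdepth {I : Ideal (MvPolynomial σ K)}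
    (D : StanleyDecomposition I) : ℕ∞ :=
  ⨅ i, ((D.Z i).card : ℕ∞)

/-- The Stanley depth of the ideal `I`: the largest Stanley depth of a Stanley decomposition of
`I`. The zero ideal has the empty decomposition, so its Stanley depth is `∞`. -/
noncomputable def sdepth (I : Ideal (MvPolynomial σ K)) : ℕ∞ :=
  ⨆ D : StanleyDecomposition I, D.sdepth

variable (σ K) in
open Classical in
/-- The depth of a finitely generated `S`-module `M` with respect to the ideal `𝔪` generated by
the variables: the largest length of an `M`-regular sequence in `𝔪`, with the usual convention
that it is `∞` if `𝔪 M = M` (for graded `M`: if `M = 0`). -/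
noncomputable def depth (M : Type*) [AddCommGroup M] [Module (MvPolynomial σ K) M] : ℕ∞ :=
  if MvPolynomial.idealOfVars σ K • (⊤ : Submodule (MvPolynomial σ K) M) = ⊤ then ⊤
  else ⨆ (rs : List (MvPolynomial σ K)) (_ : (∀ f ∈ rs, f ∈ MvPolynomial.idealOfVars σ K) ∧
    RingTheory.Sequence.IsRegular M rs), (rs.length : ℕ∞)

end StanleyDepth

/-! Let U be the family of supports of monomials in I; its complement is the simplicial complex Δ
with Stanley–Reisner ring S/I. A partition of U into intervals [a, b] with all |b| ≥ d yields sdepth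
I ≥ d (`HasIntervalPartition.le_sdepth`). So if S/I has a weakly regular sequence of length t in the
ideal of the variables, it suffices to partition U with tops of size at least t + 1.

Depth enters only through Koszul cohomology, which vanishes below degree t on any elements y whose
radical contains the variables (`KoszulVanishes.of_isWeaklyRegular`). Explicit cocycles then show
that facets of Δ have at least t vertices (`not_koszulVanishes_of_facet`) and, if t ≥ 3, that no
vertex has a disconnected link (`not_koszulVanishes_of_disconnected_link`). For sequences on I, the
exact sequence 0 → I → S → S/I → 0 shifts degrees by one.

The rest is combinatorics on five vertices, with t ≤ 4. For t ≤ 2, the smallest non-faces are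
matched into sets with one more element. For t = 3, the complements of the members of U, apart from
the whole set, are the nonempty cliques of a graph. An induced four-cycle would disconnect the link
of the fifth vertex, so the graph is chordal or a five-cycle, and its cliques split into intervals
[{v}, D v]. For t = 4 the ideal is principal. -/

namespace StanleyDepth

/-! ### Koszul cochains on words, and vanishing from regular sequences. -/

section Koszul

variable {σ R M N : Type*} [CommRing R] [AddCommGroup M] [Module R M] [AddCommGroup N] [Module R N]

/-- The Koszul-type differential on cochains indexed by words in `σ`: it sends `c` to
`(v₀, …, vₙ) ↦ ∑ (-1)ᵏ y (vₖ) c (v₀, …, v̂ₖ, …, vₙ)`. -/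
def koszulD (y : σ → R) : (List σ → M) → List σ → M
  | _, [] => 0
  | c, v :: s => y v • c s - koszulD y (fun t => c (v :: t)) s

@[simp] lemma koszulD_nil (y : σ → R) (c : List σ → M) : koszulD y c [] = 0 := by
  rw [koszulD]

lemma koszulD_cons (y : σ → R) (c : List σ → M) (v : σ) (s : List σ) :
    koszulD y c (v :: s) = y v • c s - koszulD y (fun t => c (v :: t)) s := by
  rw [koszulD]

lemma koszulD_add (y : σ → R) (b c : List σ → M) (s : List σ) :
    koszulD y (fun t => b t + c t) s = koszulD y b s + koszulD y c s := by
  induction s generalizing b c with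
  | nil => simp
  | cons v s ih => simp only [koszulD_cons, ih, smul_add]; abel

lemma koszulD_smul (y : σ → R) (r : R) (c : List σ → M) (s : List σ) :
    koszulD y (fun t => r • c t) s = r • koszulD y c s := by
  induction s generalizing c with
  | nil => simp
  | cons v s ih => simp only [koszulD_cons, ih, smul_sub, smul_comm r]

@[simp] lemma koszulD_zero (y : σ → R) (s : List σ) :
    koszulD y (fun _ => (0 : M)) s = 0 := by
  simpa using koszulD_smul y 0 (fun _ => (0 : M)) s

lemma koszulD_sub (y : σ → R) (b c : List σ → M) (s : List σ) :
    koszulD y (fun t => b t - c t) s = koszulD y b s - koszulD y c s := by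
  have h := koszulD_add y b (fun t => (-1 : R) • c t) s
  rw [koszulD_smul] at h
  simpa [sub_eq_add_neg] using h

lemma koszulD_sum {ι : Type*} (y : σ → R) (A : Finset ι) (c : ι → List σ → M) (s : List σ) :
    koszulD y (fun t => ∑ i ∈ A, c i t) s = ∑ i ∈ A, koszulD y (c i) s := by
  classical
  induction A using Finset.induction_on with
  | empty => simp
  | insert i A hi ih =>
    simp only [Finset.sum_insert hi]
    rw [koszulD_add, ih]

/-- Cochains live on words of all lengths at once; this locality allows identities known in one
degree to be used under `koszulD`. -/
lemma koszulD_congr (y : σ → R) {b c : List σ → M} {s : List σ}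
    (h : ∀ t : List σ, t.length + 1 = s.length → b t = c t) :
    koszulD y b s = koszulD y c s := by
  induction s generalizing b c with
  | nil => simp
  | cons v s ih =>
    rw [koszulD_cons, koszulD_cons, h s (by simp)]
    congr 1
    exact ih fun t ht => h _ (by simpa using ht)

lemma koszulD_congr_left {y z : σ → R} (c : List σ → M) {s : List σ} (h : ∀ v ∈ s, y v = z v) :
    koszulD y c s = koszulD z c s := by
  induction s generalizing c with
  | nil => simp
  | cons v s ih =>
    rw [koszulD_cons, koszulD_cons, h v (by simp), ih _ fun w hw => h w (by simp [hw])]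

lemma koszulD_zero_left (c : List σ → M) (s : List σ) : koszulD (fun _ => (0 : R)) c s = 0 := by
  induction s generalizing c with
  | nil => simp
  | cons v s ih => simp [koszulD_cons, ih]

lemma koszulD_sum_left {ι : Type*} (A : Finset ι) (r : ι → R) (y : ι → σ → R) (c : List σ → M)
    (s : List σ) :
    koszulD (fun v => ∑ i ∈ A, r i * y i v) c s = ∑ i ∈ A, r i • koszulD (y i) c s := by
  induction s generalizing c with
  | nil => simp
  | cons v s ih =>
    simp only [koszulD_cons, ih, Finset.sum_smul, smul_sub, Finset.sum_sub_distrib, mul_smul]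

lemma map_koszulD (f : M →ₗ[R] N) (y : σ → R) (c : List σ → M) (s : List σ) :
    f (koszulD y c s) = koszulD y (fun t => f (c t)) s := by
  induction s generalizing c with
  | nil => simp
  | cons v s ih => simp [koszulD_cons, ih]

lemma koszulD_koszulD_cons (y z : σ → R) (c : List σ → M) (v : σ) (s : List σ) :
    koszulD y (koszulD z c) (v :: s) = y v • koszulD z c s - (z v • koszulD y c s -
      koszulD y (koszulD z fun t => c (v :: t)) s) := by
  conv_rhs => rw [← koszulD_smul y (z v) c, ← koszulD_sub]
  rw [koszulD_cons]
  simp only [koszulD_cons]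

/-- `koszulD y` is the signed shuffle product with the one-cochain `y`, and one-cochains
anticommute. -/
lemma koszulD_anticomm (y z : σ → R) (c : List σ → M) (s : List σ) :
    koszulD y (koszulD z c) s + koszulD z (koszulD y c) s = 0 := by
  induction s generalizing c with
  | nil => simp
  | cons v s ih =>
    rw [koszulD_koszulD_cons, koszulD_koszulD_cons, ← ih fun t => c (v :: t)]
    abel

/-- Anticommutation gives only twice this, which does not suffice in characteristic two. -/
lemma koszulD_koszulD (y : σ → R) (c : List σ → M) (s : List σ) :
    koszulD y (koszulD y c) s = 0 := by
  induction s generalizing c with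
  | nil => simp
  | cons v s ih =>
    rw [koszulD_koszulD_cons, ih]
    abel

/-- Contracting cochains with `a` is a homotopy between `∑ a v * y v` and zero. -/
lemma sum_smul_eq_koszulD [Fintype σ] (y a : σ → R) (c : List σ → M) (s : List σ)
    (hc : ∀ v, koszulD y c (v :: s) = 0) :
    (∑ v, a v * y v) • c s = koszulD y (fun t => ∑ v, a v • c (v :: t)) s := by
  rw [koszulD_sum y Finset.univ fun v t => a v • c (v :: t), Finset.sum_smul]
  refine Finset.sum_congr rfl fun v _ => ?_
  have h := hc v
  rw [koszulD_cons, sub_eq_zero] at h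
  rw [koszulD_smul, ← h, mul_smul]

/-- Vanishing of the cohomology of the complex of cochains on words in degree `i`. -/
def KoszulVanishes (y : σ → R) (M : Type*) [AddCommGroup M] [Module R M] (i : ℕ) : Prop :=
  ∀ c : List σ → M, (∀ s : List σ, s.length = i + 1 → koszulD y c s = 0) →
    ∃ b : List σ → M, ∀ s : List σ, s.length = i → c s = koszulD y b s

-- Modulo `f` the primitive `b` is a cocycle one degree lower, hence a coboundary there. Subtracting
-- the differential of a lift makes `b` divisible by `f`, and `f` cancels.
open Pointwise in
lemma koszulD_eq_of_smul_eq {y : σ → R} {f : R} {i : ℕ} (hf : IsSMulRegular M f)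
    (hv : ∀ j < i, KoszulVanishes y (QuotSMulTop f M) j) (c : List σ → M)
    (h : ∃ b : List σ → M, ∀ s : List σ, s.length = i → f • c s = koszulD y b s) :
    ∃ b : List σ → M, ∀ s : List σ, s.length = i → c s = koszulD y b s := by
  obtain ⟨b, hb⟩ := h
  rcases i with _ | j
  · refine ⟨fun _ => 0, fun s hs => ?_⟩
    obtain rfl := List.length_eq_zero_iff.mp hs
    have := hb [] rfl
    rw [koszulD_nil] at this ⊢
    exact hf (by simpa using this)
  · let π : M →ₗ[R] QuotSMulTop f M := Submodule.mkQ _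
    have hπ : Function.Surjective π := Submodule.mkQ_surjective _
    have hker : ∀ m : M, π m = 0 → ∃ m' : M, m = f • m' := by
      intro m hm
      have : m ∈ f • (⊤ : Submodule R M) := by simpa [π] using hm
      obtain ⟨m', -, rfl⟩ := this
      exact ⟨m', rfl⟩
    have hf0 : ∀ m : M, π (f • m) = 0 := by
      intro m
      have : f • m ∈ f • (⊤ : Submodule R M) := ⟨m, trivial, rfl⟩
      exact (Submodule.Quotient.mk_eq_zero _).mpr this
    obtain ⟨e, he⟩ := hv j (Nat.lt_succ_self j) (fun t => π (b t)) fun s hs => by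
      rw [← map_koszulD, ← hb s hs, hf0]
    choose g hg using hπ
    -- The length condition sits inside the existential so that `choose` yields a cochain on all
    -- words.
    have key : ∀ s : List σ, ∃ m : M, s.length = j →
        b s - koszulD y (fun t => g (e t)) s = f • m := by
      intro s
      by_cases hs : s.length = j
      · obtain ⟨m, hm⟩ := hker (b s - koszulD y (fun t => g (e t)) s) (by
          rw [map_sub, he s hs, map_koszulD]; simp [hg])
        exact ⟨m, fun _ => hm⟩
      · exact ⟨0, fun h => absurd h hs⟩
    choose b' hb' using key
    refine ⟨b', fun s hs => hf ?_⟩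
    change f • c s = f • koszulD y b' s
    rw [hb s hs, ← koszulD_smul, koszulD_congr y (c := fun t =>
        b t - koszulD y (fun t => g (e t)) t) (fun t ht => (hb' t (by omega)).symm),
      koszulD_sub]
    have := koszulD_koszulD y (fun t => g (e t)) s
    rw [this, sub_zero]

/-- A weakly regular sequence in the radical of `(y)` makes the low cohomology vanish. -/
theorem KoszulVanishes.of_isWeaklyRegular [Fintype σ] {M : Type*} [AddCommGroup M] [Module R M]
    {y : σ → R} {rs : List R} (hr : RingTheory.Sequence.IsWeaklyRegular M rs)
    (hy : ∀ f ∈ rs, f ∈ (Ideal.span (Set.range y)).radical) {i : ℕ} (hi : i < rs.length) :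
    KoszulVanishes y M i := by
  induction rs generalizing M i with
  | nil => simp at hi
  | cons f rs ih =>
    rw [RingTheory.Sequence.isWeaklyRegular_cons_iff] at hr
    obtain ⟨hf, hr⟩ := hr
    have hq : ∀ j < i, KoszulVanishes y (QuotSMulTop f M) j := fun j hj =>
      ih hr (fun g hg => hy g (by simp [hg])) (by simp at hi; omega)
    intro c hc
    obtain ⟨n, hn⟩ := hy f (by simp)
    obtain ⟨a, ha⟩ := (Ideal.mem_span_range_iff_exists_fun).mp hn
    have hstart : ∃ b : List σ → M, ∀ s : List σ, s.length = i → f ^ n • c s = koszulD y b s :=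
      ⟨_, fun s hs => by
        rw [← ha]; exact sum_smul_eq_koszulD y a c s fun v => hc _ (by simp [hs])⟩
    clear ha hn
    -- Descend from `f ^ n • c` to `c`, removing one factor `f` at a time.
    induction n with
    | zero => simpa using hstart
    | succ n ihn =>
      refine ihn (koszulD_eq_of_smul_eq hf hq _ ?_)
      simpa only [pow_succ', mul_smul] using hstart

/-- A piece of the long exact sequence: the differential of a lift of `c` is a cocycle in `P`, and
subtracting a primitive of it makes the lift a cocycle in `M`. -/
lemma KoszulVanishes.quotient {y : σ → R} (P : Submodule R M) {i : ℕ}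
    (hM : KoszulVanishes y M i) (hP : KoszulVanishes y P (i + 1)) :
    KoszulVanishes y (M ⧸ P) i := by
  classical
  intro c hc
  choose g hg using P.mkQ_surjective
  let c' : List σ → M := fun s => g (c s)
  have hmem : ∀ s : List σ, s.length = i + 1 → koszulD y c' s ∈ P := by
    intro s hs
    rw [← Submodule.Quotient.mk_eq_zero, ← Submodule.mkQ_apply, map_koszulD]
    simpa [c', hg] using hc s hs
  let p : List σ → P := fun s =>
    if hs : s.length = i + 1 then ⟨koszulD y c' s, hmem s hs⟩ else 0
  have hp : ∀ s : List σ, s.length = i + 1 → (p s : M) = koszulD y c' s := by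
    intro s hs
    simp [p, hs]
  obtain ⟨b, hb⟩ := hP p fun s hs => by
    apply P.subtype_injective
    rw [map_koszulD, map_zero, ← koszulD_koszulD y c' s]
    exact koszulD_congr y fun t ht => hp t (by omega)
  obtain ⟨e, he⟩ := hM (fun s => c' s - b s) fun s hs => by
    rw [koszulD_sub, ← hp s hs, hb s hs, sub_eq_zero]
    exact map_koszulD P.subtype y b s
  refine ⟨fun t => P.mkQ (e t), fun s hs => ?_⟩
  rw [← map_koszulD, ← he s hs, map_sub, hg, Submodule.mkQ_apply,
    (Submodule.Quotient.mk_eq_zero P).mpr (b s).2, sub_zero]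

/-- The alternating cochain dual to the word `e`, with value `z` at `e`. -/
def koszulDual [DecidableEq σ] (R : Type*) [CommRing R] {M : Type*} [AddCommGroup M] [Module R M]
    (z : M) : List σ → List σ → M
  | [] => fun s => if s = [] then z else 0
  | v :: e => koszulD (Pi.single v (1 : R)) (koszulDual R z e)

lemma smul_koszulDual [DecidableEq σ] {z : M} {r : R} (h : r • z = 0) (e s : List σ) :
    r • koszulDual R z e s = 0 := by
  induction e generalizing s with
  | nil => simp only [koszulDual]; split_ifs <;> simp [h]
  | cons v e ih => rw [koszulDual, ← koszulD_smul]; simp [ih]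

lemma koszulD_single_koszulDual [DecidableEq σ] (z : M) {e : List σ} {v : σ} (hv : v ∈ e)
    (s : List σ) : koszulD (Pi.single v (1 : R)) (koszulDual R z e) s = 0 := by
  induction e generalizing s with
  | nil => simp at hv
  | cons w e ih =>
    rw [koszulDual]
    by_cases h : v = w
    · subst h; exact koszulD_koszulD _ _ _
    · have := koszulD_anticomm (Pi.single v (1 : R)) (Pi.single w (1 : R)) (koszulDual R z e) s
      have h2 := ih (by simpa [h] using hv)
      rw [koszulD_congr (Pi.single w (1 : R)) (fun t _ => h2 t), koszulD_zero, add_zero] at this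
      exact this

lemma koszulDual_self [DecidableEq σ] (z : M) {e : List σ} (he : e.Nodup) :
    koszulDual R z e e = z := by
  induction e with
  | nil => simp [koszulDual]
  | cons v e ih =>
    rw [List.nodup_cons] at he
    rw [koszulDual, koszulD_cons, ih he.2, koszulD_congr_left (z := fun _ => 0), koszulD_zero_left]
    · simp
    · intro w hw
      rw [Pi.single_eq_of_ne]
      rintro rfl
      exact he.1 hw

/-- Expand `y` in the dual basis: terms with `v ∈ e` repeat a factor, and in the others `y v` kills
`z`. -/
lemma koszulD_koszulDual [Fintype σ] [DecidableEq σ] {y : σ → R} {z : M} {e : List σ}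
    (h : ∀ v ∉ e, y v • z = 0) (s : List σ) : koszulD y (koszulDual R z e) s = 0 := by
  have hy : y = fun w => ∑ v, y v * Pi.single (M := fun _ => R) v (1 : R) w := by
    ext w; simp [Pi.single_apply]
  rw [hy, koszulD_sum_left]
  refine Finset.sum_eq_zero fun v _ => ?_
  by_cases hv : v ∈ e
  · rw [koszulD_single_koszulDual z hv, smul_zero]
  · rw [← koszulD_smul]
    simp [smul_koszulDual (h v hv)]

lemma koszulD_mem (y : σ → R) (b : List σ → M) (s : List σ) :
    koszulD y b s ∈ Ideal.span (y '' {v | v ∈ s}) • (⊤ : Submodule R M) := by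
  induction s generalizing b with
  | nil => simp
  | cons v s ih =>
    rw [koszulD_cons]
    refine sub_mem (Submodule.smul_mem_smul (Ideal.subset_span ⟨v, by simp, rfl⟩) trivial) ?_
    refine Submodule.smul_mono_left (Ideal.span_mono (Set.image_mono ?_)) (ih _)
    intro w hw
    exact List.mem_cons_of_mem v hw

/-- If the cohomology vanishes in degree `|e|`, an element killed by the `y v` with `v ∉ e` lies
in the submodule generated by the `y v` with `v ∈ e`. -/
theorem KoszulVanishes.mem_smul_top [Fintype σ] {y : σ → R} {z : M} {e : List σ}
    (he : e.Nodup) (hv : KoszulVanishes y M e.length) (h : ∀ v ∉ e, y v • z = 0) :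
    z ∈ Ideal.span (y '' {v | v ∈ e}) • (⊤ : Submodule R M) := by
  classical
  obtain ⟨b, hb⟩ := hv (koszulDual R z e) fun s _ => koszulD_koszulDual h s
  rw [← koszulDual_self (R := R) z he, hb e rfl]
  exact koszulD_mem y b e

/-- Vanishing in degree two, applied to the product of a one-cocycle on the variables other than
`e` with the dual of `e`. -/
theorem KoszulVanishes.exists_of_cocycle [DecidableEq σ] {y : σ → R} (hv : KoszulVanishes y M 2)
    (e : σ) (m : σ → M) (he : m e = 0)
    (hm : ∀ v w, v ≠ e → w ≠ e → y v • m w = y w • m v) :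
    ∃ (b : σ → M), ∀ v ≠ e, ∃ g : M, m v = y e • g - y v • b e := by
  let μ : List σ → M := fun s => match s with
    | [v] => m v
    | _ => 0
  -- Away from `e` the cochain is closed, and `m e = 0`; so its differential is `y e` times its
  -- product with the dual of `e`. By anticommutation that product is a cocycle.
  have h2 : ∀ s : List σ, s.length = 2 →
      koszulD y μ s = y e • koszulD (Pi.single e (1 : R)) μ s := by
    intro s hs
    obtain ⟨v, w, rfl⟩ := List.length_eq_two.mp hs
    simp only [koszulD_cons, koszulD_nil, sub_zero, μ]
    by_cases h1 : v = e <;> by_cases h3 : w = e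
    · simp [h1, h3, he]
    · simp [h1, h3, he]
    · simp [h1, h3, he]
    · simp [h1, h3, hm v w h1 h3]
  obtain ⟨b, hb⟩ := hv (koszulD (Pi.single e (1 : R)) μ) fun s hs => by
    have h := koszulD_anticomm y (Pi.single e (1 : R)) μ s
    rw [koszulD_congr (Pi.single e (1 : R)) (b := koszulD y μ) fun t ht => h2 t (by omega),
      koszulD_smul, koszulD_koszulD, smul_zero, add_zero] at h
    exact h
  refine ⟨fun v => b [v], fun v hve => ⟨b [v], ?_⟩⟩
  have := hb [e, v] rfl
  simpa [koszulD_cons, μ, hve] using this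

end Koszul

open MvPolynomial

/-! ### Squarefree monomial ideals and their families of supports. -/

section MonomialIdeal

variable {σ K : Type*} [Field K]

/-- The upward closed family of sets generated by `G`. -/
def upperFamily (G : Set (Finset σ)) (F : Finset σ) : Prop := ∃ s ∈ G, s ⊆ F

lemma upperFamily.mono {G : Set (Finset σ)} {F F' : Finset σ} (h : upperFamily G F) (hF : F ⊆ F') :
    upperFamily G F' :=
  let ⟨s, hs, hsF⟩ := h
  ⟨s, hs, hsF.trans hF⟩

/-- The exponent of the squarefree monomial with support `s`. -/
noncomputable def sqfExp (s : Finset σ) : σ →₀ ℕ := ∑ i ∈ s, Finsupp.single i 1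

lemma sqfExp_apply [DecidableEq σ] (s : Finset σ) (i : σ) : sqfExp s i = if i ∈ s then 1 else 0 := by
  simp [sqfExp, Finsupp.finsetSum_apply, Finsupp.single_apply]

@[simp] lemma support_sqfExp (s : Finset σ) : (sqfExp s).support = s := by
  classical
  ext i
  simp [sqfExp_apply]

lemma sqfExp_le_iff {s : Finset σ} {m : σ →₀ ℕ} : sqfExp s ≤ m ↔ s ⊆ m.support := by
  classical
  constructor
  · intro h i hi
    have := h i
    rw [sqfExp_apply, if_pos hi] at this
    rw [Finsupp.mem_support_iff]
    omega
  · intro h i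
    rw [sqfExp_apply]
    split_ifs with hi
    · exact Nat.one_le_iff_ne_zero.mpr (Finsupp.mem_support_iff.mp (h hi))
    · exact Nat.zero_le _

lemma prod_X_eq_monomial (s : Finset σ) :
    ∏ i ∈ s, (X i : MvPolynomial σ K) = monomial (sqfExp s) 1 := by
  rw [sqfExp, monomial_sum_one]
  rfl

/-- The squarefree monomial ideal generated by `G`. -/
noncomputable def sqfIdeal (K : Type*) [Field K] (G : Set (Finset σ)) : Ideal (MvPolynomial σ K) :=
  Ideal.span ((fun s : Finset σ => ∏ i ∈ s, (X i : MvPolynomial σ K)) '' G)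

lemma mem_sqfIdeal {G : Set (Finset σ)} {f : MvPolynomial σ K} :
    f ∈ sqfIdeal K G ↔ ∀ m ∈ f.support, upperFamily G m.support := by
  have h : (fun s : Finset σ => ∏ i ∈ s, (X i : MvPolynomial σ K)) '' G =
      (fun m => monomial m (1 : K)) '' (sqfExp '' G) := by
    simp only [Set.image_image, prod_X_eq_monomial]
  rw [sqfIdeal, h, mem_ideal_span_monomial_image]
  simp [upperFamily, sqfExp_le_iff]

lemma monomial_mem_sqfIdeal {G : Set (Finset σ)} {m : σ →₀ ℕ} {r : K}
    (h : upperFamily G m.support) : monomial m r ∈ sqfIdeal K G := by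
  classical
  rw [mem_sqfIdeal]
  intro n hn
  have := support_monomial_subset hn
  rw [Finset.mem_singleton] at this
  rwa [this]

lemma coeff_eq_zero_of_mem_sqfIdeal {G : Set (Finset σ)} {f : MvPolynomial σ K}
    (hf : f ∈ sqfIdeal K G) {m : σ →₀ ℕ} (hm : ¬ upperFamily G m.support) : coeff m f = 0 := by
  by_contra h
  exact hm (mem_sqfIdeal.mp hf m (mem_support_iff.mpr h))

lemma sqfIdeal_eq_top {G : Set (Finset σ)} (h : upperFamily G ∅) : sqfIdeal K G = ⊤ := by
  rw [Ideal.eq_top_iff_one]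
  have := monomial_mem_sqfIdeal (K := K) (m := 0) (r := 1) (by simpa using h)
  simpa using this

lemma sqfIdeal_eq_bot {G : Set (Finset σ)} [Fintype σ] (h : ¬ upperFamily G Finset.univ) :
    sqfIdeal K G = ⊥ := by
  rw [eq_bot_iff]
  intro f hf
  rw [Submodule.mem_bot, ← support_eq_empty, Finset.eq_empty_iff_forall_notMem]
  intro m hm
  exact h ((mem_sqfIdeal.mp hf m hm).mono (Finset.subset_univ _))

end MonomialIdeal

/-! ### Nonzero Koszul classes from facets and disconnected links. -/

section Koszul

variable {σ K : Type*} [Field K] [DecidableEq σ]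

/-- The variables, with those in `F` replaced by their squares. -/
noncomputable def squaredVars (K : Type*) [Field K] (F : Finset σ) (v : σ) : MvPolynomial σ K :=
  if v ∈ F then X v ^ 2 else X v

lemma idealOfVars_le_radical_squaredVars (F : Finset σ) :
    idealOfVars σ K ≤ (Ideal.span (Set.range (squaredVars K F))).radical := by
  rw [idealOfVars, Ideal.span_le]
  rintro _ ⟨v, rfl⟩
  have h : squaredVars K F v ∈ Ideal.span (Set.range (squaredVars K F)) :=
    Ideal.subset_span ⟨v, rfl⟩
  rw [squaredVars] at h
  split_ifs at h
  · exact ⟨2, h⟩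
  · exact Ideal.le_radical h

/-- A facet with `n` vertices of a simplicial complex yields nonzero Koszul cohomology of its
Stanley–Reisner ring in degree `n`. -/
theorem not_koszulVanishes_of_facet [Fintype σ] {G : Set (Finset σ)} {F : Finset σ}
    (hF : ¬ upperFamily G F) (hmax : ∀ v ∉ F, upperFamily G (insert v F)) :
    ¬ KoszulVanishes (squaredVars K F) (MvPolynomial σ K ⧸ sqfIdeal K G) F.card := by
  intro hv
  -- As `F` is a facet, every variable outside `F` kills x^F in S/I.
  have key := KoszulVanishes.mem_smul_top (e := F.toList)
    (z := Ideal.Quotient.mk (sqfIdeal K G) (monomial (sqfExp F) 1))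
    F.nodup_toList (by rwa [Finset.length_toList]) (by
      intro v hvF
      rw [Finset.mem_toList] at hvF
      rw [squaredVars, if_neg hvF]
      change Ideal.Quotient.mk (sqfIdeal K G) (X v * monomial (sqfExp F) 1) = 0
      rw [Ideal.Quotient.eq_zero_iff_mem, X, monomial_mul]
      refine monomial_mem_sqfIdeal ((hmax v hvF).mono fun w hw => ?_)
      rw [Finsupp.mem_support_iff, Finsupp.add_apply, sqfExp_apply]
      rcases Finset.mem_insert.mp hw with rfl | hw
      · simp
      · simp [hw])
  have hcoeff : ∀ f ∈ sqfIdeal K G, coeff (sqfExp F) f = 0 := fun f hf =>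
    coeff_eq_zero_of_mem_sqfIdeal hf (by rwa [support_sqfExp])
  -- Here the squares matter: x^F is divisible by x_v for v ∈ F, but not by x_v².
  have hJ : ∀ f ∈ Ideal.span (squaredVars K F '' {v | v ∈ F.toList}), coeff (sqfExp F) f = 0 := by
    have himg : squaredVars K F '' {v | v ∈ F.toList} =
        (fun m => monomial m (1 : K)) '' ((fun v => Finsupp.single v 2) '' {v | v ∈ F}) := by
      ext f
      simp only [Set.mem_image, exists_exists_and_eq_and, Finset.mem_toList, Set.mem_ofPred_eq]
      refine exists_congr fun v => and_congr_right fun hvF => ?_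
      rw [squaredVars, if_pos hvF, X_pow_eq_monomial]
    intro f hf
    rw [himg, mem_ideal_span_monomial_image] at hf
    by_contra h
    obtain ⟨_, ⟨v, -, rfl⟩, hle⟩ := hf _ (mem_support_iff.mpr h)
    have := hle v
    rw [sqfExp_apply, Finsupp.single_eq_same] at this
    split_ifs at this <;> omega
  have hall : ∀ w ∈ Ideal.span (squaredVars K F '' {v | v ∈ F.toList}) •
      (⊤ : Submodule (MvPolynomial σ K) (MvPolynomial σ K ⧸ sqfIdeal K G)),
      ∀ p, Ideal.Quotient.mk (sqfIdeal K G) p = w → coeff (sqfExp F) p = 0 := by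
    intro w hw
    refine Submodule.smul_induction_on hw ?_ ?_
    · intro r hr n _ p hp
      obtain ⟨q, rfl⟩ := Ideal.Quotient.mk_surjective n
      have h1 : p - r * q ∈ sqfIdeal K G := by
        rw [← Ideal.Quotient.eq, hp]; rfl
      have h2 := hJ _ (Ideal.mul_mem_right q _ hr)
      have h3 := hcoeff _ h1
      rwa [coeff_sub, h2, sub_zero] at h3
    · intro x y hx hy p hp
      obtain ⟨q, rfl⟩ := Ideal.Quotient.mk_surjective x
      obtain ⟨q', rfl⟩ := Ideal.Quotient.mk_surjective y
      have h1 : p - (q + q') ∈ sqfIdeal K G := by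
        rw [← Ideal.Quotient.eq, hp, map_add]
      have h3 := hcoeff _ h1
      rwa [coeff_sub, coeff_add, hx q rfl, hy q' rfl, add_zero, sub_zero] at h3
  have := hall _ key _ rfl
  rw [coeff_monomial, if_pos rfl] at this
  exact one_ne_zero this

/-- A disconnected link of a vertex `e` yields nonzero Koszul cohomology of the Stanley–Reisner
ring in degree two. -/
theorem not_koszulVanishes_of_disconnected_link {G : Set (Finset σ)} {e : σ} (p : σ → Prop)
    (hp : ∀ v w, v ≠ e → w ≠ e → p v → ¬ p w → upperFamily G {v, w, e}) {a b : σ}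
    (ha : p a) (hae : a ≠ e) (hGa : ¬ upperFamily G {a, e})
    (hb : ¬ p b) (hbe : b ≠ e) (hGb : ¬ upperFamily G {b, e}) :
    ¬ KoszulVanishes (squaredVars K {e}) (MvPolynomial σ K ⧸ sqfIdeal K G) 2 := by
  classical
  intro hv
  let π := Ideal.Quotient.mk (sqfIdeal K G)
  have hy : ∀ v, v ≠ e → squaredVars K {e} v = X v := by
    intro v hve
    simp [squaredVars, hve]
  have hye : squaredVars K {e} e = X e ^ 2 := by simp [squaredVars]
  have hzero : ∀ v w, v ≠ e → w ≠ e → p v → ¬ p w → π (X w * (X v * X e)) = 0 := by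
    intro v w h1 h2 h3 h4
    rw [Ideal.Quotient.eq_zero_iff_mem]
    simp only [X, monomial_mul]
    refine monomial_mem_sqfIdeal ((hp v w h1 h2 h3 h4).mono fun u hu => ?_)
    simp only [Finset.mem_insert, Finset.mem_singleton] at hu
    rcases hu with rfl | rfl | rfl <;> simp
  -- The cochain is x_v x_e on the side `p` of the link and zero on the other; it is closed because
  -- x_v x_w x_e ∈ I across the sides.
  obtain ⟨β, hβ⟩ := hv.exists_of_cocycle e
    (fun v => if p v ∧ v ≠ e then π (X v * X e) else 0) (by simp) (by
      intro v w h1 h2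
      rw [hy v h1, hy w h2]
      by_cases h3 : p v <;> by_cases h4 : p w
      · simp only [h3, h4, h1, h2, ne_eq, not_false_eq_true, and_self, if_true]
        change π (X v * (X w * X e)) = π (X w * (X v * X e))
        congr 1; ring
      · simp only [h3, h4, h1, ne_eq, not_false_eq_true, and_self, false_and, if_true, if_false,
          smul_zero]
        exact (hzero v w h1 h2 h3 h4).symm
      · simp only [h3, h4, h2, ne_eq, not_false_eq_true, and_self, false_and, if_true, if_false,
          smul_zero]
        exact hzero w v h2 h1 h4 h3
      · simp [h3, h4])
  obtain ⟨q, hq⟩ := Ideal.Quotient.mk_surjective (β e)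
  -- The coefficient of x_v x_e ignores multiples of x_e², so it is the same constant for all
  -- neighbours of `e`; yet `a` gives 1 and `b` gives 0.
  have main : ∀ v, v ≠ e → ¬ upperFamily G {v, e} → ∀ r : MvPolynomial σ K,
      (if p v ∧ v ≠ e then π (X v * X e) else 0) = π r →
      coeff (Finsupp.single v 1 + Finsupp.single e 1) r = - coeff (Finsupp.single e 1) q := by
    intro v hve hG r hr
    obtain ⟨g, hg⟩ := hβ v hve
    obtain ⟨g', rfl⟩ := Ideal.Quotient.mk_surjective g
    rw [hr, ← hq, hy v hve, hye] at hg
    have hmem : r - (X e ^ 2 * g' - X v * q) ∈ sqfIdeal K G := by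
      rw [← Ideal.Quotient.eq]; exact hg
    have h := coeff_eq_zero_of_mem_sqfIdeal hmem (m := Finsupp.single v 1 + Finsupp.single e 1) (by
      refine fun h => hG (h.mono fun u hu => ?_)
      rcases Finset.mem_union.mp (Finsupp.support_add hu) with h | h
      · have := Finsupp.support_single_subset h; simp_all
      · have := Finsupp.support_single_subset h; simp_all)
    have h1 : coeff (Finsupp.single v 1 + Finsupp.single e 1) (X e ^ 2 * g') = 0 := by
      rw [X_pow_eq_monomial, coeff_monomial_mul', if_neg]
      intro hle
      have := hle e
      simp [hve] at this
    rw [coeff_sub, coeff_sub, h1, coeff_X_mul] at h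
    linear_combination h
  have h1 := main a hae hGa (X a * X e) (by rw [if_pos ⟨ha, hae⟩])
  have h2 := main b hbe hGb 0 (by rw [if_neg (fun h => hb h.1), map_zero])
  rw [coeff_zero] at h2
  rw [← h2, coeff_X_mul, coeff_X] at h1
  simp at h1

end Koszul

/-! ### The variables as a regular sequence on S. -/

section Depth

variable {σ K : Type*} [Field K]

lemma isWeaklyRegular_map_X {l : List σ} (hl : l.Nodup) :
    RingTheory.Sequence.IsWeaklyRegular (MvPolynomial σ K)
      (l.map (X : σ → MvPolynomial σ K)) := by
  classical
  constructor
  intro i hi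
  rw [List.length_map] at hi
  have hspan : Ideal.ofList ((l.map (X : σ → MvPolynomial σ K)).take i) •
      (⊤ : Submodule (MvPolynomial σ K) (MvPolynomial σ K)) =
      Ideal.span (X '' {v | v ∈ l.take i}) := by
    rw [smul_eq_mul, Ideal.mul_top, Ideal.ofList]
    congr 1
    ext f
    change f ∈ List.take _ _ ↔ _
    rw [← List.map_take, List.mem_map]
    rfl
  rw [isSMulRegular_iff_right_eq_zero_of_smul]
  intro x hx
  obtain ⟨f, rfl⟩ := Submodule.Quotient.mk_surjective _ x
  rw [← Submodule.Quotient.mk_smul, Submodule.Quotient.mk_eq_zero, hspan] at hx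
  rw [Submodule.Quotient.mk_eq_zero, hspan]
  rw [List.getElem_map, smul_eq_mul] at hx
  rw [mem_ideal_span_X_image] at hx ⊢
  intro m hm
  obtain ⟨v, hv, hne⟩ := hx (Finsupp.single l[i] 1 + m) (by
    rw [mem_support_iff, coeff_X_mul]
    exact mem_support_iff.mp hm)
  refine ⟨v, hv, ?_⟩
  have hvi : l[i] ≠ v := by
    rintro rfl
    have hv' : l[i] ∈ l.take i := hv
    obtain ⟨j, hj, hje⟩ := List.mem_take_iff_getElem.mp hv'
    have := (List.Nodup.getElem_inj_iff hl).mp hje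
    omega
  simpa [hvi] using hne

lemma koszulVanishes_mvPolynomial [Fintype σ] {y : σ → MvPolynomial σ K}
    (hy : idealOfVars σ K ≤ (Ideal.span (Set.range y)).radical) {i : ℕ} (hi : i < Fintype.card σ) :
    KoszulVanishes y (MvPolynomial σ K) i := by
  refine KoszulVanishes.of_isWeaklyRegular (isWeaklyRegular_map_X Finset.univ.nodup_toList) ?_
    (by simpa using hi)
  intro f hf
  obtain ⟨v, -, rfl⟩ := List.mem_map.mp hf
  exact hy (Ideal.subset_span ⟨v, rfl⟩)

end Depth

/-! ### Stanley decompositions from interval partitions. -/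

section Decomposition

variable {σ K : Type*} [Field K]

/-- The family `U` has a partition into intervals whose top elements have at least `d`
elements. -/
def HasIntervalPartition (U : Finset σ → Prop) (d : ℕ) : Prop :=
  ∃ (r : ℕ) (a b : Fin r → Finset σ), (∀ i, U (a i) ∧ a i ⊆ b i ∧ d ≤ (b i).card) ∧
    ∀ F, U F → ∃! i, a i ⊆ F ∧ F ⊆ b i

lemma HasIntervalPartition.of_finite {ι : Type*} [Finite ι] {U : Finset σ → Prop} {d : ℕ}
    (a b : ι → Finset σ) (h : ∀ i, U (a i) ∧ a i ⊆ b i ∧ d ≤ (b i).card)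
    (hU : ∀ F, U F → ∃! i, a i ⊆ F ∧ F ⊆ b i) : HasIntervalPartition U d := by
  obtain ⟨r, ⟨f⟩⟩ := Finite.exists_equiv_fin ι
  refine ⟨r, a ∘ f.symm, b ∘ f.symm, fun i => h _, fun F hF => ?_⟩
  obtain ⟨i, hi, huniq⟩ := hU F hF
  refine ⟨f i, by simpa using hi, fun j hj => ?_⟩
  rw [← huniq (f.symm j) hj, Equiv.apply_symm_apply]

/-- Reduces directness and exhaustion of a decomposition to each support lying in exactly one
interval. -/
lemma stanleySpace_eq_restrictSupport {A B : Finset σ} (h : A ⊆ B) :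
    stanleySpace (monomial (sqfExp A) (1 : K)) B =
      restrictSupport K {m | A ⊆ m.support ∧ m.support ⊆ B} := by
  classical
  apply le_antisymm
  · rintro _ ⟨f, hf, rfl⟩
    have hf' : (f.vars : Set σ) ⊆ B := mem_supported.mp hf
    rw [mem_restrictSupport_iff]
    intro m hm
    rw [Finset.mem_coe, mem_support_iff, LinearMap.mulLeft_apply, coeff_monomial_mul'] at hm
    split_ifs at hm with hle
    · have hA := sqfExp_le_iff.mp hle
      refine ⟨hA, fun v hv => ?_⟩
      by_cases hvA : v ∈ A
      · exact h hvA
      · refine hf' ((mem_vars_iff_mem_support v).mpr ⟨m - sqfExp A, ?_, ?_⟩)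
        · rw [mem_support_iff]
          intro h0; simp [h0] at hm
        · rw [Finsupp.mem_support_iff] at hv ⊢
          simpa [sqfExp_apply, hvA] using hv
    · exact absurd rfl hm
  · rw [restrictSupport_eq_span, Submodule.span_le]
    rintro _ ⟨m, ⟨hA, hB⟩, rfl⟩
    have hle := sqfExp_le_iff.mpr hA
    refine ⟨monomial (m - sqfExp A) 1, ?_, ?_⟩
    · refine mem_supported.mpr ?_
      rw [vars_monomial one_ne_zero]
      exact fun v hv => hB (Finsupp.support_mono tsub_le_self hv)
    · rw [LinearMap.mulLeft_apply, monomial_mul, add_tsub_cancel_of_le hle, one_mul]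

lemma HasIntervalPartition.le_sdepth {G : Set (Finset σ)} {d : ℕ}
    (h : HasIntervalPartition (upperFamily G) d) : (d : ℕ∞) ≤ sdepth (sqfIdeal K G) := by
  obtain ⟨r, a, b, hab, hU⟩ := h
  have hspace : ∀ i, stanleySpace (monomial (sqfExp (a i)) (1 : K)) (b i) =
      restrictSupport K {m | a i ⊆ m.support ∧ m.support ⊆ b i} := fun i =>
    stanleySpace_eq_restrictSupport (hab i).2.1
  let D : StanleyDecomposition (sqfIdeal K G) :=
    { r := r
      u := fun i => monomial (sqfExp (a i)) 1
      Z := b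
      mem := fun i => monomial_mem_sqfIdeal (by simpa using (hab i).1)
      homogeneous := fun i => ⟨_, _, rfl⟩
      ne_zero := fun i => by simp
      independent := by
        intro i
        have hle : ⨆ j, ⨆ (_ : j ≠ i), stanleySpace (monomial (sqfExp (a j)) (1 : K)) (b j) ≤
            restrictSupport K {m | a i ⊆ m.support ∧ m.support ⊆ b i}ᶜ := by
          refine iSup₂_le fun j hj => ?_
          rw [hspace]
          refine restrictSupport_mono K fun m hm hmi => hj ?_
          exact (hU m.support ((hab j).1.mono hm.1)).unique hm hmi
        refine Disjoint.mono_right hle ?_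
        change Disjoint (stanleySpace (monomial (sqfExp (a i)) (1 : K)) (b i)) _
        rw [hspace, Submodule.disjoint_def]
        intro f h1 h2
        rw [mem_restrictSupport_iff] at h1 h2
        rw [← support_eq_empty, Finset.eq_empty_iff_forall_notMem]
        exact fun m hm => h2 hm (h1 hm)
      iSup_eq := by
        simp only [hspace]
        apply le_antisymm
        · refine iSup_le fun i f hf => ?_
          rw [mem_restrictSupport_iff] at hf
          exact mem_sqfIdeal.mpr fun m hm => (hab i).1.mono (hf hm).1
        · intro f hf
          rw [f.as_sum]
          refine Submodule.sum_mem _ fun m hm => ?_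
          obtain ⟨i, hi, -⟩ := hU _ (mem_sqfIdeal.mp hf m hm)
          refine Submodule.mem_iSup_of_mem i ?_
          rw [monomial_mem_restrictSupport]
          exact Or.inl hi }
  have hD : (d : ℕ∞) ≤ D.sdepth := le_iInf fun i => by exact_mod_cast (hab i).2.2
  exact hD.trans (le_iSup (fun D : StanleyDecomposition (sqfIdeal K G) => D.sdepth) D)

end Decomposition

/-! ### Graphs on five vertices without induced four-cycles. -/

section FiveVertexGraphs

/-- The adjacency function of the graph on five vertices with the given edges. -/
def graphOfBits (a b c d e f g h i j : Bool) : Fin 5 → Fin 5 → Bool :=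
  ![![false, a, b, c, d], ![a, false, e, f, g], ![b, e, false, h, i], ![c, f, h, false, j],
    ![d, g, i, j, false]]

variable {α : Type*} (E : α → α → Bool)

/-- If `v x w y` is a four-cycle, then it has a chord. -/
def fourCycleChord (v w x y : α) : Bool :=
  E v w || (E x y || !(E v x && (E x w && (E w y && E y v))))

/-- All four-cycles on the four given vertices have chords. -/
def fourCycleChords (v w x y : α) : Bool :=
  fourCycleChord E v w x y && (fourCycleChord E v x w y && fourCycleChord E v y w x)

/-- The neighbours of `v` among the four other vertices are pairwise adjacent. -/
def isSimplicial (v a b c d : α) : Bool :=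
  (!(E v a) || ((!(E v b) || E a b) && ((!(E v c) || E a c) && (!(E v d) || E a d)))) &&
  ((!(E v b) || ((!(E v c) || E b c) && (!(E v d) || E b d))) &&
  (!(E v c) || (!(E v d) || E c d)))

/-- The vertices form an induced five-cycle in the given order. -/
def isFiveCycle (o p q s t : α) : Bool :=
  E o p && (E p q && (E q s && (E s t && (E t o &&
    !(E o q || (E q t || (E t p || (E p s || E s o))))))))

/-- The vertices form an induced five-cycle in which `o` and `p` are adjacent. -/
def isFiveCycles (o p q s t : α) : Bool :=
  isFiveCycle E o p q s t || (isFiveCycle E o p q t s || (isFiveCycle E o p s q t ||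
   (isFiveCycle E o p s t q || (isFiveCycle E o p t q s || isFiveCycle E o p t s q))))

/-- Either there is a simplicial vertex, or the graph is a five-cycle, or it has an induced
four-cycle. -/
def fiveVertexCheck (E : Fin 5 → Fin 5 → Bool) : Bool :=
  isSimplicial E 0 1 2 3 4 || (isSimplicial E 1 0 2 3 4 || (isSimplicial E 2 0 1 3 4 ||
  (isSimplicial E 3 0 1 2 4 || (isSimplicial E 4 0 1 2 3 ||
  (isFiveCycles E 0 1 2 3 4 || (isFiveCycles E 0 2 1 3 4 || (isFiveCycles E 0 3 1 2 4 ||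
  !(fourCycleChords E 0 1 2 3 && (fourCycleChords E 0 1 2 4 && (fourCycleChords E 0 1 3 4 &&
    (fourCycleChords E 0 2 3 4 && fourCycleChords E 1 2 3 4)))))))))))

-- Ten bits encode a graph, so the kernel decides all 1024 cases.
set_option maxRecDepth 100000 in
lemma fiveVertexCheck_graphOfBits : ∀ a b c d e f g h i j : Bool,
    fiveVertexCheck (graphOfBits a b c d e f g h i j) = true := by
  decide +kernel

lemma fiveVertexCheck_eq_true {E : Fin 5 → Fin 5 → Bool} (hs : ∀ v w, E v w = E w v)
    (hl : ∀ v, E v v = false) : fiveVertexCheck E = true := by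
  have h : E = graphOfBits (E 0 1) (E 0 2) (E 0 3) (E 0 4) (E 1 2) (E 1 3) (E 1 4) (E 2 3) (E 2 4)
      (E 3 4) := by
    funext v w
    fin_cases v <;> fin_cases w <;> first | exact hl _ | rfl | exact hs _ _
  rw [h]
  exact fiveVertexCheck_graphOfBits _ _ _ _ _ _ _ _ _ _

variable {E}

lemma fourCycleChords_eq_true
    (h : ∀ v w x y, v ≠ w → v ≠ x → v ≠ y → w ≠ x → w ≠ y → x ≠ y → E v x = true → E x w = true →
      E w y = true → E y v = true → E v w = true ∨ E x y = true) {v w x y : α}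
    (h1 : v ≠ w) (h2 : v ≠ x) (h3 : v ≠ y) (h4 : w ≠ x) (h5 : w ≠ y) (h6 : x ≠ y) :
    fourCycleChords E v w x y = true := by
  have key : ∀ v w x y, v ≠ w → v ≠ x → v ≠ y → w ≠ x → w ≠ y → x ≠ y →
      fourCycleChord E v w x y = true := by
    intro v w x y h1 h2 h3 h4 h5 h6
    have := h v w x y h1 h2 h3 h4 h5 h6
    rw [fourCycleChord]
    revert this
    cases E v w <;> cases E x y <;> cases E v x <;> cases E x w <;> cases E w y <;>
      cases E y v <;> simp
  rw [fourCycleChords, key v w x y h1 h2 h3 h4 h5 h6, key v x w y h2 h1 h3 h4.symm h6 h5,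
    key v y w x h3 h1 h2 h5.symm h6.symm h4]
  rfl

lemma adj_of_isSimplicial (hs : ∀ v w, E v w = E w v) {v a b c d : α}
    (h : isSimplicial E v a b c d = true) (hu : ∀ x, x = v ∨ x = a ∨ x = b ∨ x = c ∨ x = d)
    {x y : α} (hx : x ≠ v) (hy : y ≠ v) (hxy : x ≠ y) (hvx : E v x = true) (hvy : E v y = true) :
    E x y = true := by
  simp only [isSimplicial, Bool.and_eq_true, Bool.or_eq_true, Bool.not_eq_true'] at h
  rcases hu x with rfl | rfl | rfl | rfl | rfl <;> rcases hu y with rfl | rfl | rfl | rfl | rfl <;>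
    first
    | exact absurd rfl hx
    | exact absurd rfl hy
    | exact absurd rfl hxy
    | simp_all

/-- The vertices of `E` are arranged in a five-cycle by `p`. -/
def IsCycleArrangement (E : α → α → Bool) (p : Fin 5 → α) : Prop :=
  ∀ i j, i ≠ j → (E (p i) (p j) = true ↔ j = i + 1 ∨ i = j + 1)

lemma isCycleArrangement_of_isFiveCycle (hs : ∀ v w, E v w = E w v) {o p q s t : α}
    (h : isFiveCycle E o p q s t = true) : IsCycleArrangement E ![o, p, q, s, t] := by
  simp only [isFiveCycle, Bool.and_eq_true, Bool.not_eq_true', Bool.or_eq_false_iff] at h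
  obtain ⟨h1, h2, h3, h4, h5, h6, h7, h8, h9, h10⟩ := h
  have h1' := h1; have h2' := h2; have h3' := h3; have h4' := h4; have h5' := h5
  have h6' := h6; have h7' := h7; have h8' := h8; have h9' := h9; have h10' := h10
  rw [hs] at h1' h2' h3' h4' h5' h6' h7' h8' h9' h10'
  intro i j hij
  fin_cases i <;> fin_cases j <;> first | exact absurd rfl hij | simp [*]

lemma exists_isCycleArrangement_of_isFiveCycles (hs : ∀ v w, E v w = E w v) {o p q s t : α}
    (hn : [o, p, q, s, t].Nodup) (h : isFiveCycles E o p q s t = true) :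
    ∃ f : Fin 5 → α, Function.Injective f ∧ IsCycleArrangement E f := by
  have key : ∀ q' s' t', [o, p, q', s', t'].Nodup → isFiveCycle E o p q' s' t' = true →
      ∃ f : Fin 5 → α, Function.Injective f ∧ IsCycleArrangement E f := by
    intro q' s' t' hn h
    refine ⟨_, ?_, isCycleArrangement_of_isFiveCycle hs h⟩
    simp only [List.nodup_cons, List.mem_cons, not_or, List.not_mem_nil, not_false_eq_true] at hn
    intro i j hij
    fin_cases i <;> fin_cases j <;> first | rfl | (simp at hij; grind)
  simp only [isFiveCycles, Bool.or_eq_true] at h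
  have hperm : ∀ l : List α, l.Perm [q, s, t] → (o :: p :: l).Nodup := fun l hl =>
    ((hl.cons p).cons o).nodup_iff.mpr hn
  rcases h with h | h | h | h | h | h <;> refine key _ _ _ (hperm _ ?_) h
  · rfl
  · exact (List.Perm.swap _ _ _).cons _
  · exact List.Perm.swap _ _ _
  · exact ((List.Perm.swap _ _ _).cons _).trans (List.Perm.swap _ _ _)
  · exact (List.Perm.swap _ _ _).trans ((List.Perm.swap _ _ _).cons _)
  · exact (List.Perm.swap _ _ _).trans (((List.Perm.swap _ _ _).cons _).trans
      (List.Perm.swap _ _ _))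

/-- A graph on five vertices without induced four-cycles has a simplicial vertex or is a
five-cycle. -/
lemma exists_simplicial_or_cycle {E : Fin 5 → Fin 5 → Bool} (hs : ∀ v w, E v w = E w v)
    (hl : ∀ v, E v v = false)
    (h : ∀ v w x y, v ≠ w → v ≠ x → v ≠ y → w ≠ x → w ≠ y → x ≠ y → E v x = true → E x w = true →
      E w y = true → E y v = true → E v w = true ∨ E x y = true) :
    (∃ v, ∀ x y, x ≠ v → y ≠ v → x ≠ y → E v x = true → E v y = true → E x y = true) ∨
      ∃ p : Fin 5 → Fin 5, Function.Injective p ∧ IsCycleArrangement E p := by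
  have hc := fiveVertexCheck_eq_true hs hl
  have h4 : ∀ {v w x y : Fin 5}, v ≠ w → v ≠ x → v ≠ y → w ≠ x → w ≠ y → x ≠ y →
      fourCycleChords E v w x y = true := fun h1 h2 h3 h4 h5 h6 =>
    fourCycleChords_eq_true h h1 h2 h3 h4 h5 h6
  rw [fiveVertexCheck, h4, h4, h4, h4, h4] at hc
  any_goals decide
  simp only [Bool.or_eq_true, Bool.and_self, Bool.not_true, or_false, Bool.false_eq_true] at hc
  rcases hc with hc | hc | hc | hc | hc | hc | hc | hc
  iterate 5
    · exact Or.inl ⟨_, fun x y hx hy hxy h1 h2 =>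
        adj_of_isSimplicial hs hc (by decide) hx hy hxy h1 h2⟩
  all_goals exact Or.inr (exists_isCycleArrangement_of_isFiveCycles hs (by decide) hc)

end FiveVertexGraphs

/-! ### Partitioning cliques by simplicial elimination. -/

section Elimination

variable {σ : Type*} [DecidableEq σ]

/-- If every nonempty vertex set has a simplicial vertex, then the nonempty cliques are partitioned
into intervals `[{v}, D v]`. -/
lemma exists_clique_partition {r : σ → σ → Prop}
    (h : ∀ W : Finset σ, W.Nonempty → ∃ v ∈ W, ∀ x ∈ W, ∀ y ∈ W, r v x → r v y → r x y)
    (W : Finset σ) :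
    ∃ D : σ → Finset σ, (∀ v ∈ W, D v ⊆ W ∧ (r v v → v ∈ D v) ∧ ∀ x ∈ D v, ∀ y ∈ D v, r x y) ∧
      ∀ C ⊆ W, C.Nonempty → (∀ x ∈ C, ∀ y ∈ C, r x y) → ∃! v, v ∈ C ∧ C ⊆ D v := by
  classical
  induction W using Finset.strongInduction with
  | H W ih =>
    rcases W.eq_empty_or_nonempty with rfl | hW
    · refine ⟨fun _ => ∅, by simp, fun C hC hne => ?_⟩
      rw [Finset.subset_empty] at hC
      exact absurd hC hne.ne_empty
    · obtain ⟨u, hu, hsimp⟩ := h W hW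
      obtain ⟨D, hD, hpart⟩ := ih (W.erase u) (Finset.erase_ssubset hu)
      -- Cliques through `u` are taken up by the neighbourhood of `u`; all others are cliques in
      -- `W.erase u`.
      refine ⟨Function.update D u {x ∈ W | r u x}, fun v hv => ?_, fun C hC hne hcl => ?_⟩
      · by_cases hvu : v = u
        · subst hvu
          rw [Function.update_self]
          refine ⟨Finset.filter_subset _ _, fun h => by simp [hu, h], fun x hx y hy => ?_⟩
          rw [Finset.mem_filter] at hx hy
          exact hsimp x hx.1 y hy.1 hx.2 hy.2
        · rw [Function.update_of_ne hvu]
          obtain ⟨h1, h2, h3⟩ := hD v (Finset.mem_erase.mpr ⟨hvu, hv⟩)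
          exact ⟨h1.trans (Finset.erase_subset _ _), h2, h3⟩
      · by_cases huC : u ∈ C
        · refine ⟨u, ⟨huC, fun x hx => ?_⟩, fun v hv => ?_⟩
          · rw [Function.update_self, Finset.mem_filter]
            exact ⟨hC hx, hcl u huC x hx⟩
          · by_contra hvu
            have hv2 := hv.2
            rw [Function.update_of_ne hvu] at hv2
            have := (hD v (Finset.mem_erase.mpr ⟨hvu, hC hv.1⟩)).1 (hv2 huC)
            exact Finset.notMem_erase _ _ this
        · have hne' : ∀ v ∈ C, v ≠ u := fun v hv h => huC (h ▸ hv)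
          obtain ⟨v, hv, huniq⟩ := hpart C (Finset.subset_erase.mpr ⟨hC, huC⟩) hne hcl
          refine ⟨v, ⟨hv.1, ?_⟩, fun w hw => huniq w ⟨hw.1, ?_⟩⟩
          · rw [Function.update_of_ne (hne' v hv.1)]
            exact hv.2
          · have := hw.2
            rwa [Function.update_of_ne (hne' w hw.1)] at this

/-- On five vertices, the nonempty cliques of a graph without induced four-cycles are partitioned
into intervals `[{v}, D v]`; loops mark the vertices that are present. -/
lemma exists_clique_partition_fin_five {r : Fin 5 → Fin 5 → Prop} (hs : ∀ v w, r v w → r w v)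
    (hl : ∀ v w, r v w → r v v)
    (h4 : ∀ v w x y, v ≠ w → v ≠ x → v ≠ y → w ≠ x → w ≠ y → x ≠ y → r v x → r x w →
      r w y → r y v → r v w ∨ r x y) :
    ∃ D : Fin 5 → Finset (Fin 5), (∀ v, r v v → v ∈ D v ∧ ∀ x ∈ D v, ∀ y ∈ D v, r x y) ∧
      ∀ C : Finset (Fin 5), C.Nonempty → (∀ x ∈ C, ∀ y ∈ C, r x y) → ∃! v, v ∈ C ∧ C ⊆ D v := by
  classical
  by_cases h : ∀ W : Finset (Fin 5), W.Nonempty →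
      ∃ v ∈ W, ∀ x ∈ W, ∀ y ∈ W, r v x → r v y → r x y
  · obtain ⟨D, hD, hpart⟩ := exists_clique_partition h Finset.univ
    exact ⟨D, fun v hv => ⟨(hD v (by simp)).2.1 hv, (hD v (by simp)).2.2⟩,
      fun C hne hcl => hpart C (by simp) hne hcl⟩
  push Not at h
  obtain ⟨W, ⟨w, hw⟩, hW⟩ := h
  have hloop : ∀ v ∈ W, r v v := by
    intro v hv
    obtain ⟨x, -, y, -, h1, -⟩ := hW v hv
    exact hl v x h1
  -- Joining the vertices outside `W` to everything creates no induced four-cycle, and no simplicial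
  -- vertex either, as one outside `W` would make `W` a clique.
  let E : Fin 5 → Fin 5 → Bool := fun v w => decide (v ≠ w ∧ (v ∉ W ∨ w ∉ W ∨ r v w))
  have hE : ∀ v w, E v w = true ↔ v ≠ w ∧ (v ∉ W ∨ w ∉ W ∨ r v w) := fun v w => by simp [E]
  have hEr : ∀ v w, v ∈ W → w ∈ W → v ≠ w → (E v w = true ↔ r v w) := by
    intro v w h1 h2 h3
    rw [hE]; simp [h1, h2, h3]
  have hEs : ∀ v w, E v w = E w v := by
    intro v w
    rw [Bool.eq_iff_iff, hE, hE]
    have := hs v w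
    have := hs w v
    tauto
  have key := exists_simplicial_or_cycle (E := E) hEs (fun v => by simp [E]) (by
    intro v w x y h1 h2 h3 h5 h6 h7 e1 e2 e3 e4
    by_cases hv : v ∈ W
    · by_cases hw : w ∈ W
      · by_cases hx : x ∈ W
        · by_cases hy : y ∈ W
          · rw [hEr _ _ hv hx h2] at e1
            rw [hEr _ _ hx hw h5.symm] at e2
            rw [hEr _ _ hw hy h6] at e3
            rw [hEr _ _ hy hv h3.symm] at e4
            rw [hEr _ _ hv hw h1, hEr _ _ hx hy h7]
            exact h4 v w x y h1 h2 h3 h5 h6 h7 e1 e2 e3 e4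
          · exact Or.inr ((hE _ _).mpr ⟨h7, Or.inr (Or.inl hy)⟩)
        · exact Or.inr ((hE _ _).mpr ⟨h7, Or.inl hx⟩)
      · exact Or.inl ((hE _ _).mpr ⟨h1, Or.inr (Or.inl hw)⟩)
    · exact Or.inl ((hE _ _).mpr ⟨h1, Or.inl hv⟩))
  rcases key with ⟨v, hv⟩ | ⟨p, hinj, hp⟩
  · exfalso
    by_cases hvW : v ∈ W
    · obtain ⟨x, hx, y, hy, h1, h2, h3⟩ := hW v hvW
      have hxy : x ≠ y := by rintro rfl; exact h3 (hloop x hx)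
      have hxv : x ≠ v := by rintro rfl; exact h3 h2
      have hyv : y ≠ v := by rintro rfl; exact h3 (hs _ _ h1)
      exact h3 ((hEr x y hx hy hxy).mp (hv x y hxv hyv hxy
        ((hEr v x hvW hx hxv.symm).mpr h1) ((hEr v y hvW hy hyv.symm).mpr h2)))
    · obtain ⟨x, hx, y, hy, h1, h2, h3⟩ := hW w hw
      have hxy : x ≠ y := by rintro rfl; exact h3 (hloop x hx)
      have hne : ∀ z ∈ W, z ≠ v := fun z hz h => hvW (h ▸ hz)
      exact h3 ((hEr x y hx hy hxy).mp (hv x y (hne x hx) (hne y hy) hxy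
        ((hE _ _).mpr ⟨(hne x hx).symm, Or.inl hvW⟩)
        ((hE _ _).mpr ⟨(hne y hy).symm, Or.inl hvW⟩)))
  · have hbij := Finite.injective_iff_bijective.mp hinj
    -- In a five-cycle no vertex is joined to all others.
    have hmem : ∀ v, v ∈ W := by
      intro v
      by_contra hvW
      obtain ⟨i, rfl⟩ := hbij.2 v
      have hi : ∀ i : Fin 5, i ≠ i + 2 := by decide
      have hi' : ∀ i : Fin 5, ¬ (i + 2 = i + 1 ∨ i = i + 2 + 1) := by decide
      exact hi' i ((hp i (i + 2) (hi i)).mp ((hE _ _).mpr ⟨fun h => hi i (hinj h), Or.inl hvW⟩))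
    have hr : ∀ i j, r (p i) (p j) ↔ i = j ∨ j = i + 1 ∨ i = j + 1 := by
      intro i j
      by_cases hij : i = j
      · subst hij; simp [hloop _ (hmem _)]
      · rw [← hp i j hij, hEr _ _ (hmem _) (hmem _) fun h => hij (hinj h)]
        simp [hij]
    let e := Equiv.ofBijective p hbij
    have he : ∀ i, e.symm (p i) = i := fun i => e.symm_apply_apply i
    -- Orient the cycle and assign each edge to its first vertex.
    refine ⟨fun v => {v, p (e.symm v + 1)}, fun v _ => ⟨by simp, ?_⟩, fun C hne hcl => ?_⟩
    · obtain ⟨i, rfl⟩ := hbij.2 v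
      simp [he, hr]
    · have hcyc : ∀ B : Finset (Fin 5), B.Nonempty →
          (∀ i ∈ B, ∀ j ∈ B, i = j ∨ j = i + 1 ∨ i = j + 1) →
          ∃ i, (i ∈ B ∧ B ⊆ {i, i + 1}) ∧ ∀ j, j ∈ B ∧ B ⊆ {j, j + 1} → j = i := by
        decide
      obtain ⟨i, hi, huniq⟩ := hcyc (C.map e.symm.toEmbedding) (by simpa using hne) (by
        intro i hi j hj
        rw [← hr]
        simp only [Finset.mem_map_equiv, Equiv.symm_symm] at hi hj
        exact hcl _ hi _ hj)
      have hiff : ∀ j, (j ∈ C.map e.symm.toEmbedding ∧ C.map e.symm.toEmbedding ⊆ {j, j + 1}) ↔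
          (p j ∈ C ∧ C ⊆ {p j, p (e.symm (p j) + 1)}) := by
        intro j
        rw [he, Finset.mem_map_equiv, Equiv.symm_symm]
        refine and_congr_right fun _ => ⟨fun h x hx => ?_, fun h x hx => ?_⟩
        · obtain ⟨k, rfl⟩ := hbij.2 x
          have := h (show k ∈ _ by rw [Finset.mem_map_equiv, Equiv.symm_symm]; exact hx)
          simp only [Finset.mem_insert, Finset.mem_singleton] at this ⊢
          rcases this with rfl | rfl <;> simp
        · rw [Finset.mem_map_equiv, Equiv.symm_symm] at hx
          have := h (show p x ∈ C from hx)
          simp only [Finset.mem_insert, Finset.mem_singleton] at this ⊢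
          exact this.imp (fun h => hinj h) fun h => hinj h
      refine ⟨p i, (hiff i).mp hi, fun v hv => ?_⟩
      obtain ⟨j, rfl⟩ := hbij.2 v
      rw [huniq j ((hiff j).mpr hv)]

end Elimination

/-! ### Interval partitions from matchings. -/

section Partition

variable {σ : Type*} [DecidableEq σ]

/-- A family `U` is upward closed, and the maximal sets outside of it have at least `t` elements. -/
structure IsUpperWithFacets (U : Finset σ → Prop) (t : ℕ) : Prop where
  mono : ∀ ⦃F F'⦄, U F → F ⊆ F' → U F'
  not_empty : ¬ U ∅
  le_card : ∀ F, ¬ U F → (∀ v ∉ F, U (insert v F)) → t ≤ F.card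

variable {U : Finset σ → Prop} {t : ℕ}

lemma IsUpperWithFacets.exists_facet [Fintype σ] (h : IsUpperWithFacets U t) {F : Finset σ}
    (hF : ¬ U F) : ∃ F', F ⊆ F' ∧ ¬ U F' ∧ t ≤ F'.card := by
  obtain ⟨F', hle, hmax⟩ := (Set.toFinite {F' | ¬ U F'}).exists_le_maximal hF
  refine ⟨F', hle, hmax.prop, h.le_card F' hmax.prop fun v hv => ?_⟩
  by_contra hU
  exact hv (hmax.le_of_ge hU (Finset.subset_insert v F') (Finset.mem_insert_self v F'))

/-- If the members of `U` among the subsets of the vertex set `W` of the complement of `U` have at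
least `k` elements, and those with `k` elements are matched into sets with `k + 1` elements, then
`U` has a partition into intervals whose tops have at least `k + 1` elements. -/
lemma hasIntervalPartition_of_matching [Fintype σ] [LinearOrder σ] {k : ℕ} (W : Finset σ)
    (hW : ∀ v, v ∈ W ↔ ¬ U {v}) (hk : k ≤ W.card)
    (hcard : ∀ F ⊆ W, U F → k ≤ F.card) (φ : Finset σ → Finset σ)
    (hφ : ∀ F ⊆ W, U F → F.card = k → F ⊆ φ F ∧ φ F ⊆ W ∧ (φ F).card = k + 1)
    (hinj : ∀ F ⊆ W, U F → F.card = k → ∀ F' ⊆ W, U F' → F'.card = k → φ F = φ F' → F = F') :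
    HasIntervalPartition U (k + 1) := by
  classical
  let P : Finset σ → Prop := fun F => U F ∧ F ⊆ W ∧
    (F.card = k ∨ ∀ E, U E → E ⊆ W → E.card = k → φ E ≠ F)
  let top : Finset σ → Finset σ := fun F => if F.card = k then φ F else F
  have htop : ∀ F, P F → F ⊆ top F ∧ top F ⊆ W ∧ k + 1 ≤ (top F).card := by
    rintro F ⟨h1, h2, -⟩
    by_cases hF : F.card = k
    · simp only [top, if_pos hF]
      exact ⟨(hφ F h2 h1 hF).1, (hφ F h2 h1 hF).2.1, (hφ F h2 h1 hF).2.2.ge⟩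
    · simp only [top, if_neg hF]
      exact ⟨subset_rfl, h2, Nat.lt_of_le_of_ne (hcard F h2 h1) (Ne.symm hF)⟩
  -- Sets not inside `W` are sorted by their least element `v` outside `W`; the top `W ∪ {u | v ≤
  -- u}` has at least |W| + 1 elements. Inside `W`, k-sets pair with their matches and unmatched
  -- larger sets stand alone.
  refine HasIntervalPartition.of_finite (ι := {v // v ∉ W} ⊕ {F // P F})
    (Sum.elim (fun v => {v.1}) fun F => F.1)
    (Sum.elim (fun v => Finset.univ.filter fun u => u ∈ W ∨ v.1 ≤ u) fun F => top F.1) ?_ ?_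
  · rintro (⟨v, hv⟩ | ⟨F, hF⟩)
    · have hUv : U {v} := by
        have := hv
        rw [hW, not_not] at this
        exact this
      refine ⟨hUv, by simp, ?_⟩
      have hsub : insert v W ⊆ Finset.univ.filter fun u => u ∈ W ∨ v ≤ u := by
        intro u hu
        refine Finset.mem_filter.mpr ⟨Finset.mem_univ _, ?_⟩
        rcases Finset.mem_insert.mp hu with rfl | hu
        · exact Or.inr le_rfl
        · exact Or.inl hu
      have := Finset.card_le_card hsub
      rw [Finset.card_insert_of_notMem hv] at this
      exact le_trans (Nat.succ_le_succ hk) this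
    · exact ⟨hF.1, (htop F hF).1, (htop F hF).2.2⟩
  · intro F hF
    by_cases hFW : F ⊆ W
    · have hleft : ∀ v : {v // v ∉ W}, ¬ ({v.1} ⊆ F) := fun v hv =>
        v.2 (hFW (hv (Finset.mem_singleton_self _)))
      have main : ∃ E, P E ∧ (E ⊆ F ∧ F ⊆ top E) ∧
          ∀ E', P E' → E' ⊆ F → F ⊆ top E' → E' = E := by
        by_cases hFk : F.card = k
        · refine ⟨F, ⟨hF, hFW, Or.inl hFk⟩, ⟨subset_rfl, ?_⟩, fun E' hE' h1 _ => ?_⟩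
          · simp only [top, if_pos hFk]
            exact (hφ F hFW hF hFk).1
          · exact Finset.eq_of_subset_of_card_le h1 (hFk.trans_le (hcard E' hE'.2.1 hE'.1))
        · have hlt : k + 1 ≤ F.card := Nat.lt_of_le_of_ne (hcard F hFW hF) (Ne.symm hFk)
          have hmatch : ∀ E', P E' → E'.card = k → F ⊆ top E' → φ E' = F := by
            intro E' hE' hc h
            simp only [top, if_pos hc] at h
            exact (Finset.eq_of_subset_of_card_le h
              ((hφ E' hE'.2.1 hE'.1 hc).2.2.trans_le hlt)).symm
          by_cases hex : ∃ E, U E ∧ E ⊆ W ∧ E.card = k ∧ φ E = F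
          · obtain ⟨E, h1, h2, h3, h4⟩ := hex
            refine ⟨E, ⟨h1, h2, Or.inl h3⟩, ⟨?_, ?_⟩, fun E' hE' h5 h6 => ?_⟩
            · rw [← h4]; exact (hφ E h2 h1 h3).1
            · simp only [top, if_pos h3, h4]; rfl
            · by_cases hc : E'.card = k
              · exact hinj E' hE'.2.1 hE'.1 hc E h2 h1 h3 ((hmatch E' hE' hc h6).trans h4.symm)
              · simp only [top, if_neg hc] at h6
                obtain rfl := Finset.Subset.antisymm h5 h6
                exact absurd h4 ((hE'.2.2.resolve_left hc) E h1 h2 h3)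
          · push Not at hex
            refine ⟨F, ⟨hF, hFW, Or.inr hex⟩, ⟨subset_rfl, ?_⟩, fun E' hE' h5 h6 => ?_⟩
            · simp only [top, if_neg hFk]; rfl
            · by_cases hc : E'.card = k
              · exact absurd (hmatch E' hE' hc h6) (hex E' hE'.1 hE'.2.1 hc)
              · simp only [top, if_neg hc] at h6
                exact Finset.Subset.antisymm h5 h6
      obtain ⟨E, hE, hmem, huniq⟩ := main
      refine ⟨Sum.inr ⟨E, hE⟩, hmem, ?_⟩
      rintro (v | ⟨E', hE'⟩) hi
      · exact absurd hi.1 (hleft v)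
      · congr 1
        exact Subtype.ext (huniq E' hE' hi.1 hi.2)
    · have hne : (F \ W).Nonempty := Finset.sdiff_nonempty.mpr hFW
      have hmin := Finset.min'_mem _ hne
      rw [Finset.mem_sdiff] at hmin
      refine ⟨Sum.inl ⟨(F \ W).min' hne, hmin.2⟩, ⟨?_, ?_⟩, ?_⟩
      · simpa using hmin.1
      · intro u hu
        simp only [Sum.elim_inl, Finset.mem_filter, Finset.mem_univ, true_and]
        by_cases huW : u ∈ W
        · exact Or.inl huW
        · exact Or.inr (Finset.min'_le _ _ (Finset.mem_sdiff.mpr ⟨hu, huW⟩))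
      · rintro (⟨v, hv⟩ | ⟨E, hE⟩) hi
        · congr 1
          refine Subtype.ext (le_antisymm ?_ ?_)
          · have := hi.2 hmin.1
            simp only [Sum.elim_inl, Finset.mem_filter, Finset.mem_univ, true_and] at this
            exact this.resolve_left hmin.2
          · refine Finset.min'_le _ _ (Finset.mem_sdiff.mpr ⟨?_, hv⟩)
            exact hi.1 (Finset.mem_singleton_self _)
        · exact absurd (hi.2.trans (htop E hE).2.1) hFW

/-- If every vertex of `W` misses one of its pairs in the set `B` of pairs in `W`, then every vertex
lies on at most `|W| - 2` of them. -/
lemma card_filter_mem_le {W : Finset σ} {B : Finset (Finset σ)}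
    (hB : ∀ E ∈ B, E ⊆ W ∧ E.card = 2) (hmiss : ∀ v ∈ W, ∃ w ∈ W, w ≠ v ∧ {v, w} ∉ B) :
    ∀ v ∈ W, (B.filter (v ∈ ·)).card ≤ W.card - 2 := by
  intro v hv
  obtain ⟨w, hw, hwv, hvw⟩ := hmiss v hv
  have hsub : (B.filter (v ∈ ·)) ⊆ ((W.erase v).erase w).image fun u => {v, u} := by
    intro E hE
    rw [Finset.mem_filter] at hE
    obtain ⟨hEW, hE2⟩ := hB E hE.1
    obtain ⟨u, hu⟩ : ∃ u, E.erase v = {u} := by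
      rw [← Finset.card_eq_one, Finset.card_erase_of_mem hE.2, hE2]
    have hEe : {v, u} = E := by rw [← hu, Finset.insert_erase hE.2]
    have huE : u ∈ E.erase v := by rw [hu]; simp
    rw [Finset.mem_image]
    refine ⟨u, ?_, hEe⟩
    rw [Finset.mem_erase, Finset.mem_erase]
    refine ⟨?_, Finset.ne_of_mem_erase huE, hEW (Finset.mem_of_mem_erase huE)⟩
    rintro rfl
    exact hvw (hEe ▸ hE.1)
  refine (Finset.card_le_card hsub).trans (Finset.card_image_le.trans ?_)
  rw [Finset.card_erase_of_mem (Finset.mem_erase.mpr ⟨hwv, hw⟩), Finset.card_erase_of_mem hv]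
  omega

/-- Double counting of incidences between vertices and pairs. -/
lemma two_mul_card_le {W : Finset σ} {B : Finset (Finset σ)}
    (hB : ∀ E ∈ B, E ⊆ W ∧ E.card = 2) (hmiss : ∀ v ∈ W, ∃ w ∈ W, w ≠ v ∧ {v, w} ∉ B) :
    2 * B.card ≤ W.card * (W.card - 2) := by
  have h := Finset.sum_card_inter_le (card_filter_mem_le hB hmiss)
  rw [Finset.sum_congr rfl (g := fun _ => 2) fun E hE => by
    rw [Finset.inter_eq_right.mpr (hB E hE).1, (hB E hE).2]] at h
  rw [Finset.sum_const, smul_eq_mul] at h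
  omega

/-- A set of pairs in a four-element set such that every vertex misses one of the possible pairs
can be matched into the triples. -/
lemma exists_matching_of_card_eq_four {W : Finset σ} (hW : W.card = 4) {B : Finset (Finset σ)}
    (hB : ∀ E ∈ B, E ⊆ W ∧ E.card = 2) (hmiss : ∀ v ∈ W, ∃ w ∈ W, w ≠ v ∧ {v, w} ∉ B) :
    ∃ φ : Finset σ → Finset σ, (∀ E ∈ B, E ⊆ φ E ∧ φ E ⊆ W ∧ (φ E).card = 3) ∧
      ∀ E ∈ B, ∀ E' ∈ B, φ E = φ E' → E = E' := by
  classical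
  -- Hall's condition for choosing the vertex that the triple omits. The available vertices are `W \
  -- C`, with `C` the common part of the pairs. If `C` is empty, double counting gives |X| ≤ 4;
  -- otherwise all pairs share a vertex, so |X| ≤ 2 ≤ 4 - |C|.
  have hall : ∀ X : Finset B, X.card ≤ (X.biUnion fun E => W \ E.1).card := by
    intro X
    rcases X.eq_empty_or_nonempty with rfl | ⟨E₀, hE₀⟩
    · simp
    let X' : Finset (Finset σ) := X.map (Function.Embedding.subtype _)
    have hX' : X' ⊆ B := by
      intro E hE
      obtain ⟨E', -, rfl⟩ := Finset.mem_map.mp hE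
      exact E'.2
    have hcard : X.card = X'.card := (Finset.card_map _).symm
    have hB' : ∀ E ∈ X', E ⊆ W ∧ E.card = 2 := fun E hE => hB E (hX' hE)
    have hmiss' : ∀ v ∈ W, ∃ w ∈ W, w ≠ v ∧ {v, w} ∉ X' := fun v hv =>
      let ⟨w, h1, h2, h3⟩ := hmiss v hv
      ⟨w, h1, h2, fun h => h3 (hX' h)⟩
    let C : Finset σ := W.filter fun v => ∀ E ∈ X, v ∈ E.1
    have hunion : (X.biUnion fun E => W \ E.1) = W \ C := by
      ext v
      simp only [Finset.mem_biUnion, Finset.mem_sdiff, C, Finset.mem_filter]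
      grind
    have hCE : C ⊆ E₀.1 := fun v hv => (Finset.mem_filter.mp hv).2 E₀ hE₀
    have hC2 := Finset.card_le_card hCE
    rw [(hB _ E₀.2).2] at hC2
    have hCW : C ⊆ W := Finset.filter_subset _ _
    rw [hunion, Finset.card_sdiff_of_subset hCW, hW, hcard]
    rcases C.eq_empty_or_nonempty with h0 | ⟨v, hv⟩
    · have := two_mul_card_le hB' hmiss'
      rw [hW] at this
      rw [h0, Finset.card_empty]
      omega
    · have := card_filter_mem_le hB' hmiss' v (Finset.mem_filter.mp hv).1
      rw [Finset.filter_true_of_mem, hW] at this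
      · omega
      · intro E hE
        obtain ⟨E', hE', rfl⟩ := Finset.mem_map.mp hE
        exact (Finset.mem_filter.mp hv).2 E' hE'
  obtain ⟨f, hinj, hf⟩ := (Finset.all_card_le_biUnion_card_iff_exists_injective _).mp hall
  let φ : Finset σ → Finset σ := fun E => if hE : E ∈ B then W.erase (f ⟨E, hE⟩) else E
  have hφ : ∀ E (hE : E ∈ B), φ E = W.erase (f ⟨E, hE⟩) := fun E hE => by simp [φ, hE]
  have hfW : ∀ E : B, f E ∈ W ∧ f E ∉ E.1 := fun E => Finset.mem_sdiff.mp (hf E)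
  refine ⟨φ, fun E hE => ?_, fun E hE E' hE' h => ?_⟩
  · rw [hφ E hE]
    refine ⟨Finset.subset_erase.mpr ⟨(hB E hE).1, (hfW ⟨E, hE⟩).2⟩, Finset.erase_subset _ _, ?_⟩
    rw [Finset.card_erase_of_mem (hfW _).1, hW]
  · rw [hφ E hE, hφ E' hE'] at h
    have h1 : f ⟨E, hE⟩ = f ⟨E', hE'⟩ := by
      by_contra hne
      have : f ⟨E, hE⟩ ∈ W.erase (f ⟨E', hE'⟩) := Finset.mem_erase.mpr ⟨hne, (hfW _).1⟩
      rw [← h] at this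
      exact Finset.notMem_erase _ _ this
    exact congrArg Subtype.val (hinj h1)

end Partition

/-! ### The partitions for t ≤ 2, t = 3 and t = 4. -/

section FinFive

/-- The pairs in a five-element set can be matched into the triples. -/
lemma exists_matching_fin_five : ∃ φ : Finset (Fin 5) → Finset (Fin 5),
    (∀ E, E.card = 2 → E ⊆ φ E ∧ (φ E).card = 3) ∧
      ∀ E, E.card = 2 → ∀ E', E'.card = 2 → φ E = φ E' → E = E' := by
  -- Modulo five, {a, a+1} receives a+2 and {a, a+2} receives a+3.
  refine ⟨fun E => E ∪ Finset.univ.filter fun x =>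
    x - 1 ∈ E ∧ (x - 2 ∈ E ∨ x - 3 ∈ E), by decide, ?_⟩
  decide

variable {U : Finset (Fin 5) → Prop} {t : ℕ}

/-- Members of `U` inside the vertex set have at least two elements, so a matching is needed only
for t = 2. There every vertex lies on an edge of Δ and so misses a pair. -/
lemma IsUpperWithFacets.hasIntervalPartition_of_le_two (h : IsUpperWithFacets U t) (ht : t ≤ 2) :
    HasIntervalPartition U (t + 1) := by
  classical
  let W : Finset (Fin 5) := Finset.univ.filter fun v => ¬ U {v}
  have hW : ∀ v, v ∈ W ↔ ¬ U {v} := fun v => by simp [W]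
  have hface : ∀ F, ¬ U F → F ⊆ W := fun F hF v hv =>
    (hW v).mpr fun hUv => hF (h.mono hUv (Finset.singleton_subset_iff.mpr hv))
  have htW : t ≤ W.card := by
    obtain ⟨F, -, hF, hcard⟩ := h.exists_facet h.not_empty
    exact hcard.trans (Finset.card_le_card (hface F hF))
  have h2 : ∀ F ⊆ W, U F → 2 ≤ F.card := by
    intro F hFW hF
    by_contra hlt
    interval_cases hc : F.card
    · rw [Finset.card_eq_zero] at hc
      exact h.not_empty (hc ▸ hF)
    · obtain ⟨v, rfl⟩ := Finset.card_eq_one.mp hc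
      exact (hW v).mp (hFW (Finset.mem_singleton_self v)) hF
  rcases Nat.lt_or_eq_of_le ht with ht | rfl
  · exact hasIntervalPartition_of_matching W hW htW
      (fun F h1 h3 => by have := h2 F h1 h3; omega) id
      (fun F h1 h3 h4 => by have := h2 F h1 h3; omega)
      (fun F h1 h3 h4 => by have := h2 F h1 h3; omega)
  let B : Finset (Finset (Fin 5)) := W.powerset.filter fun E => U E ∧ E.card = 2
  have hmem : ∀ E, E ∈ B ↔ E ⊆ W ∧ U E ∧ E.card = 2 := fun E => by simp [B]
  have hB : ∀ E ∈ B, E ⊆ W ∧ E.card = 2 := fun E hE =>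
    ⟨((hmem E).mp hE).1, ((hmem E).mp hE).2.2⟩
  have hmiss : ∀ v ∈ W, ∃ w ∈ W, w ≠ v ∧ {v, w} ∉ B := by
    intro v hv
    obtain ⟨F, hvF, hF, hcard⟩ := h.exists_facet ((hW v).mp hv)
    rw [Finset.singleton_subset_iff] at hvF
    obtain ⟨w, hwF, hwv⟩ := Finset.exists_mem_ne hcard v
    refine ⟨w, hface F hF hwF, hwv, fun hvw => hF (h.mono ((hmem _).mp hvw).2.1 ?_)⟩
    simp [Finset.insert_subset_iff, hvF, hwF]
  have key : ∃ φ : Finset (Fin 5) → Finset (Fin 5),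
      (∀ E ∈ B, E ⊆ φ E ∧ φ E ⊆ W ∧ (φ E).card = 3) ∧
        ∀ E ∈ B, ∀ E' ∈ B, φ E = φ E' → E = E' := by
    have h5 : W.card ≤ 5 := by simpa using Finset.card_le_univ W
    have hle := two_mul_card_le hB hmiss
    -- By `hle` there is no pair if |W| = 2 and at most one if |W| = 3.
    interval_cases hc : W.card
    · refine ⟨id, fun E hE => ?_, fun E _ E' _ h => h⟩
      have := Finset.card_pos.mpr ⟨E, hE⟩
      omega
    · refine ⟨fun _ => W, fun E hE => ⟨(hB E hE).1, subset_rfl, hc⟩, fun E hE E' hE' _ => ?_⟩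
      exact Finset.card_le_one.mp (by omega) E hE E' hE'
    · exact exists_matching_of_card_eq_four hc hB hmiss
    · obtain ⟨φ, h1, h3⟩ := exists_matching_fin_five
      have huniv : W = Finset.univ := (Finset.card_eq_iff_eq_univ W).mp (by simpa using hc)
      exact ⟨φ, fun E hE => ⟨(h1 E (hB E hE).2).1, by simp [huniv], (h1 E (hB E hE).2).2⟩,
        fun E hE E' hE' => h3 E (hB E hE).2 E' (hB E' hE').2⟩
  obtain ⟨φ, hφ, hinj⟩ := key
  exact hasIntervalPartition_of_matching W hW htW h2 φ
    (fun F h1 h3 h4 => hφ F ((hmem F).mpr ⟨h1, h3, h4⟩))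
    (fun F h1 h3 h4 F' h1' h3' h4' =>
      hinj F ((hmem F).mpr ⟨h1, h3, h4⟩) F' ((hmem F').mpr ⟨h1', h3', h4'⟩))

/-- Join v and w when {v, w}ᶜ ∈ U. Facets omit at most two vertices, so cliques are detected by
pairs and loops. Complements turn [{v}, D v] into [(D v)ᶜ, {v}ᶜ]; the whole set is an interval by
itself. -/
lemma IsUpperWithFacets.hasIntervalPartition_four (h : IsUpperWithFacets U 3)
    (huniv : U Finset.univ)
    (h4 : ∀ v w x y, v ≠ w → v ≠ x → v ≠ y → w ≠ x → w ≠ y → x ≠ y → U {v, x}ᶜ → U {x, w}ᶜ →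
      U {w, y}ᶜ → U {y, v}ᶜ → U {v, w}ᶜ ∨ U {x, y}ᶜ) :
    HasIntervalPartition U 4 := by
  classical
  have hflag : ∀ C : Finset (Fin 5), C.Nonempty → (∀ x ∈ C, ∀ y ∈ C, U {x, y}ᶜ) → U Cᶜ := by
    intro C hne hC
    by_contra hU
    obtain ⟨F, hCF, hF, hcard⟩ := h.exists_facet hU
    have hFC : Fᶜ ⊆ C := compl_le_iff_compl_le.mp hCF
    have h0 : Fᶜ.Nonempty := by
      rw [Finset.nonempty_iff_ne_empty]
      intro h0
      rw [Finset.compl_eq_empty_iff] at h0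
      exact hF (h0 ▸ huniv)
    have h2 : Fᶜ.card ≤ 2 := by
      rw [Finset.card_compl, Fintype.card_fin]
      omega
    obtain ⟨x, y, hxy⟩ : ∃ x y, Fᶜ = {x, y} := by
      have := h0.card_pos
      interval_cases hc : Fᶜ.card
      · obtain ⟨x, hx⟩ := Finset.card_eq_one.mp hc
        exact ⟨x, x, by simp [hx]⟩
      · obtain ⟨x, y, -, hxy⟩ := Finset.card_eq_two.mp hc
        exact ⟨x, y, hxy⟩
    have hU' := hC x (hFC (by simp [hxy])) y (hFC (by simp [hxy]))
    rw [← hxy, compl_compl] at hU'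
    exact hF hU'
  obtain ⟨D, hD, hpart⟩ := exists_clique_partition_fin_five (r := fun v w => U {v, w}ᶜ)
    (fun v w hvw => by rwa [Finset.pair_comm])
    (fun v w hvw => h.mono hvw (by
      rw [Finset.compl_subset_compl]
      simp)) h4
  refine HasIntervalPartition.of_finite (ι := Option {v // U {v, v}ᶜ})
    (fun i => i.elim Finset.univ fun v => (D v.1)ᶜ) (fun i => i.elim Finset.univ fun v => {v.1}ᶜ)
    ?_ ?_
  · rintro (_ | ⟨v, hv⟩)
    · exact ⟨huniv, subset_rfl, by simp⟩
    · obtain ⟨h1, h2⟩ := hD v hv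
      refine ⟨hflag _ ⟨v, h1⟩ h2, ?_, ?_⟩
      · simpa using h1
      · simp [Finset.card_compl]
  · intro F hF
    by_cases hne : Fᶜ.Nonempty
    · have hcl : ∀ x ∈ Fᶜ, ∀ y ∈ Fᶜ, U {x, y}ᶜ := by
        intro x hx y hy
        refine h.mono hF ?_
        rw [Finset.subset_compl_comm, Finset.insert_subset_iff, Finset.singleton_subset_iff]
        exact ⟨hx, hy⟩
      obtain ⟨v, hv, huniq⟩ := hpart _ hne hcl
      refine ⟨some ⟨v, hcl v hv.1 v hv.1⟩, ⟨?_, ?_⟩, ?_⟩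
      · exact compl_le_iff_compl_le.mp hv.2
      · rw [Option.elim_some, Finset.subset_compl_comm, Finset.singleton_subset_iff]
        exact hv.1
      · rintro (_ | ⟨w, hw⟩) hi
        · have h1 : Finset.univ ⊆ F := hi.1
          rw [Finset.univ_subset_iff] at h1
          simp [h1] at hne
        · congr 1
          refine Subtype.ext (huniq w ⟨?_, compl_le_iff_compl_le.mp hi.1⟩)
          exact Finset.singleton_subset_iff.mp (Finset.subset_compl_comm.mp hi.2)
    · rw [Finset.not_nonempty_iff_eq_empty, Finset.compl_eq_empty_iff] at hne
      subst hne
      refine ⟨none, ⟨subset_rfl, subset_rfl⟩, ?_⟩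
      rintro (_ | ⟨w, hw⟩) hi
      · rfl
      · have h1 : Finset.univ ⊆ ({w}ᶜ : Finset (Fin 5)) := hi.2
        have := h1 (Finset.mem_univ w)
        simp at this

/-- Each facet omits exactly one vertex, so `U` is the single interval above the set `V` of omitted
vertices. -/
lemma IsUpperWithFacets.hasIntervalPartition_five (h : IsUpperWithFacets U 4)
    (huniv : U Finset.univ) : HasIntervalPartition U 5 := by
  classical
  let V : Finset (Fin 5) := Finset.univ.filter fun v => ¬ U {v}ᶜ
  have hV : ∀ F, U F → V ⊆ F := by
    intro F hF v hv
    by_contra hvF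
    refine (Finset.mem_filter.mp hv).2 (h.mono hF ?_)
    rwa [Finset.subset_compl_comm, Finset.singleton_subset_iff, Finset.mem_compl]
  have hUV : U V := by
    by_contra hU
    obtain ⟨F, hVF, hF, hcard⟩ := h.exists_facet hU
    have h1 : Fᶜ.card ≤ 1 := by
      rw [Finset.card_compl, Fintype.card_fin]
      omega
    interval_cases hc : Fᶜ.card
    · rw [Finset.card_eq_zero, Finset.compl_eq_empty_iff] at hc
      exact hF (hc ▸ huniv)
    · obtain ⟨v, hv⟩ := Finset.card_eq_one.mp hc
      have hvF : v ∉ F := Finset.mem_compl.mp (by simp [hv])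
      refine hvF (hVF (Finset.mem_filter.mpr ⟨Finset.mem_univ _, ?_⟩))
      rwa [← hv, compl_compl]
  exact HasIntervalPartition.of_finite (ι := Unit) (fun _ => V) (fun _ => Finset.univ)
    (fun _ => ⟨hUV, Finset.subset_univ _, by simp⟩)
    (fun F hF => ⟨(), ⟨hV F hF, Finset.subset_univ _⟩, fun _ _ => rfl⟩)

lemma IsUpperWithFacets.le_four (h : IsUpperWithFacets U t) (huniv : U Finset.univ) : t ≤ 4 := by
  obtain ⟨F, -, hF, hcard⟩ := h.exists_facet h.not_empty
  have : F.card ≠ 5 := by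
    intro h5
    rw [(Finset.card_eq_iff_eq_univ F).mp (by simpa using h5)] at hF
    exact hF huniv
  have h5 : F.card ≤ 5 := by simpa using Finset.card_le_univ F
  omega

/-- Interval partitions of upward closed families of subsets of a five-element set. -/
theorem IsUpperWithFacets.hasIntervalPartition (h : IsUpperWithFacets U t) (huniv : U Finset.univ)
    (h4 : 3 ≤ t → ∀ v w x y, v ≠ w → v ≠ x → v ≠ y → w ≠ x → w ≠ y → x ≠ y →
      U {v, x}ᶜ → U {x, w}ᶜ → U {w, y}ᶜ → U {y, v}ᶜ → U {v, w}ᶜ ∨ U {x, y}ᶜ) :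
    HasIntervalPartition U (t + 1) := by
  have ht := h.le_four huniv
  rcases Nat.lt_or_ge t 3 with h3 | h3
  · exact h.hasIntervalPartition_of_le_two (by omega)
  · interval_cases t
    · exact h.hasIntervalPartition_four huniv (h4 le_rfl)
    · exact h.hasIntervalPartition_five huniv

end FinFive

/-! ### From regular sequences to Stanley depth. -/

variable {K : Type*} [Field K]

lemma isUpperWithFacets_of_koszulVanishes {σ : Type*} [Fintype σ] [DecidableEq σ]
    {G : Set (Finset σ)} (h0 : ¬ upperFamily G ∅) {t : ℕ}
    (hv : ∀ F : Finset σ, ∀ i < t,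
      KoszulVanishes (squaredVars K F) (MvPolynomial σ K ⧸ sqfIdeal K G) i) :
    IsUpperWithFacets (upperFamily G) t where
  mono _ _ := upperFamily.mono
  not_empty := h0
  le_card F hF hmax := by
    by_contra hlt
    exact not_koszulVanishes_of_facet hF hmax (hv F _ (not_le.mp hlt))

/-- Let e be the fifth vertex. If the four-cycle had no chord, {v, w, e} and {x, y, e} would be
faces, and no edge of the link of e would join {v, w} to {x, y}. -/
lemma exists_chord_of_koszulVanishes {G : Set (Finset (Fin 5))}
    (hv : ∀ e : Fin 5,
      KoszulVanishes (squaredVars K {e}) (MvPolynomial (Fin 5) K ⧸ sqfIdeal K G) 2)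
    {v w x y : Fin 5} (h1 : v ≠ w) (h2 : v ≠ x) (h3 : v ≠ y) (h4 : w ≠ x) (h5 : w ≠ y)
    (h6 : x ≠ y) (hvx : upperFamily G {v, x}ᶜ) (hxw : upperFamily G {x, w}ᶜ)
    (hwy : upperFamily G {w, y}ᶜ) (hyv : upperFamily G {y, v}ᶜ) :
    upperFamily G {v, w}ᶜ ∨ upperFamily G {x, y}ᶜ := by
  by_contra hcon
  rw [not_or] at hcon
  have hc : ({v, w, x, y} : Finset (Fin 5)).card = 4 := by
    rw [Finset.card_insert_of_notMem, Finset.card_insert_of_notMem, Finset.card_pair h6] <;>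
      simp [*]
  obtain ⟨e, he⟩ : ∃ e, e ∉ ({v, w, x, y} : Finset (Fin 5)) := by
    by_contra hall
    push Not at hall
    rw [Finset.eq_univ_iff_forall.mpr hall] at hc
    simp at hc
  have huniv : insert e ({v, w, x, y} : Finset (Fin 5)) = Finset.univ :=
    Finset.eq_univ_of_card _ (by rw [Finset.card_insert_of_notMem he, hc]; simp)
  have hall : ∀ u, u = e ∨ u = v ∨ u = w ∨ u = x ∨ u = y := fun u => by
    simpa using huniv.ge (Finset.mem_univ u)
  simp only [Finset.mem_insert, Finset.mem_singleton, not_or] at he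
  obtain ⟨hev, hew, hex, hey⟩ := he
  refine not_koszulVanishes_of_disconnected_link (fun u => u = v ∨ u = w) ?_ (a := v) (b := x)
    (Or.inl rfl) (Ne.symm hev) ?_ ?_ (Ne.symm hex) ?_ (hv e)
  · rintro u z - hz hu hz'
    rw [not_or] at hz'
    have hz2 : z = x ∨ z = y := by
      rcases hall z with h | h | h | h | h <;> tauto
    have hmono : ∀ {A B : Finset (Fin 5)}, upperFamily G Aᶜ → (∀ s, s ∉ A → s ∈ B) →
        upperFamily G B := fun hA hAB => hA.mono fun s hs => hAB s (Finset.mem_compl.mp hs)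
    rcases hu with rfl | rfl <;> rcases hz2 with rfl | rfl
    · refine hmono hwy fun s hs => ?_
      have := hall s
      simp only [Finset.mem_insert, Finset.mem_singleton] at hs ⊢
      tauto
    · refine hmono hxw fun s hs => ?_
      have := hall s
      simp only [Finset.mem_insert, Finset.mem_singleton] at hs ⊢
      tauto
    · refine hmono hyv fun s hs => ?_
      have := hall s
      simp only [Finset.mem_insert, Finset.mem_singleton] at hs ⊢
      tauto
    · refine hmono hvx fun s hs => ?_
      have := hall s
      simp only [Finset.mem_insert, Finset.mem_singleton] at hs ⊢
      tauto
  · intro h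
    refine hcon.2 (h.mono fun s hs => ?_)
    simp only [Finset.mem_insert, Finset.mem_singleton, Finset.mem_compl] at hs ⊢
    rcases hs with rfl | rfl <;> tauto
  · rintro (h | h)
    · exact h2 h.symm
    · exact h4 h.symm
  · intro h
    refine hcon.1 (h.mono fun s hs => ?_)
    simp only [Finset.mem_insert, Finset.mem_singleton, Finset.mem_compl] at hs ⊢
    rcases hs with rfl | rfl
    · rintro (h | h)
      · exact h2 h.symm
      · exact h4 h.symm
    · tauto

/-- Vanishing of the Koszul cohomology of `S/I` below degree `t` forces the Stanley depth of `I` to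
be at least `t + 1`. -/
lemma le_sdepth_of_koszulVanishes {G : Set (Finset (Fin 5))} (h0 : ¬ upperFamily G ∅)
    (huniv : upperFamily G Finset.univ) {t : ℕ}
    (hv : ∀ F : Finset (Fin 5), ∀ i < t,
      KoszulVanishes (squaredVars K F) (MvPolynomial (Fin 5) K ⧸ sqfIdeal K G) i) :
    t ≤ 4 ∧ ((t + 1 : ℕ) : ℕ∞) ≤ sdepth (sqfIdeal K G) := by
  have h := isUpperWithFacets_of_koszulVanishes h0 hv
  refine ⟨h.le_four huniv, (h.hasIntervalPartition huniv ?_).le_sdepth⟩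
  intro ht v w x y h1 h2 h3 h4 h5 h6 e1 e2 e3 e4
  exact exists_chord_of_koszulVanishes (fun e => hv {e} 2 (by omega)) h1 h2 h3 h4 h5 h6 e1 e2 e3 e4

lemma sdepth_eq_top {G : Set (Finset (Fin 5))} (h : ¬ upperFamily G Finset.univ) :
    sdepth (sqfIdeal K G) = ⊤ := by
  refine ENat.eq_top_iff_forall_ge.mpr fun d => HasIntervalPartition.le_sdepth ?_
  exact ⟨0, Fin.elim0, Fin.elim0, fun i => i.elim0,
    fun F hF => absurd (hF.mono (Finset.subset_univ F)) h⟩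

lemma five_le_sdepth {G : Set (Finset (Fin 5))} (h : upperFamily G ∅) :
    (5 : ℕ∞) ≤ sdepth (sqfIdeal K G) := by
  refine HasIntervalPartition.le_sdepth (d := 5) (HasIntervalPartition.of_finite (ι := Unit)
    (fun _ => ∅) (fun _ => Finset.univ) (fun _ => ⟨h, Finset.empty_subset _, by simp⟩) ?_)
  exact fun F _ => ⟨(), ⟨Finset.empty_subset _, Finset.subset_univ _⟩, fun _ _ => rfl⟩

lemma idealOfVars_ne_top (σ : Type*) : idealOfVars σ K ≠ ⊤ := by
  rw [Ne, Ideal.eq_top_iff_one]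
  intro h
  have hle : idealOfVars σ K ≤ RingHom.ker (constantCoeff : MvPolynomial σ K →+* K) := by
    rw [idealOfVars, Ideal.span_le]
    rintro _ ⟨v, rfl⟩
    simp
  have := hle h
  simp at this

lemma sqfIdeal_le_idealOfVars {σ : Type*} {G : Set (Finset σ)} (h : ¬ upperFamily G ∅) :
    sqfIdeal K G ≤ idealOfVars σ K := by
  rw [sqfIdeal, Ideal.span_le]
  rintro _ ⟨s, hs, rfl⟩
  rcases s.eq_empty_or_nonempty with rfl | ⟨v, hv⟩
  · exact absurd ⟨∅, hs, subset_rfl⟩ h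
  · exact Ideal.mem_of_dvd _ (Finset.dvd_prod_of_mem _ hv) (Ideal.subset_span ⟨v, rfl⟩)

lemma idealOfVars_smul_quotient_ne_top {σ : Type*} {G : Set (Finset σ)}
    (h : ¬ upperFamily G ∅) :
    idealOfVars σ K • (⊤ : Submodule (MvPolynomial σ K) (MvPolynomial σ K ⧸ sqfIdeal K G)) ≠ ⊤ := by
  intro htop
  have hmap : Submodule.map (sqfIdeal K G).mkQ
      (idealOfVars σ K • (⊤ : Submodule (MvPolynomial σ K) (MvPolynomial σ K))) = ⊤ := by
    rw [Submodule.map_smul'', Submodule.map_top, Submodule.range_mkQ]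
    exact htop
  rw [Submodule.map_mkQ_eq_top, smul_eq_mul, Ideal.mul_top,
    sup_eq_right.mpr (sqfIdeal_le_idealOfVars h)] at hmap
  exact idealOfVars_ne_top σ hmap

/-- Otherwise I lies in every power of the ideal of the variables, and these intersect in zero by
Krull's theorem. -/
lemma idealOfVars_smul_ideal_ne_top {σ : Type*} [Finite σ] {I : Ideal (MvPolynomial σ K)}
    (hI : I ≠ ⊥) : idealOfVars σ K • (⊤ : Submodule (MvPolynomial σ K) I) ≠ ⊤ := by
  intro htop
  have hmul : idealOfVars σ K * I = I := by
    have := congrArg (Submodule.map I.subtype) htop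
    rwa [Submodule.map_smul'', Submodule.map_top, Submodule.range_subtype, smul_eq_mul] at this
  have hpow : ∀ n : ℕ, I ≤ idealOfVars σ K ^ n := by
    intro n
    induction n with
    | zero => simp
    | succ n ih =>
      rw [pow_succ']
      calc I = idealOfVars σ K * I := hmul.symm
        _ ≤ _ := Ideal.mul_mono_right ih
  refine hI (eq_bot_iff.mpr ?_)
  rw [← Ideal.iInf_pow_eq_bot_of_isDomain _ (idealOfVars_ne_top (K := K) σ)]
  exact le_iInf hpow

lemma depth_le {σ : Type*} {M : Type*} [AddCommGroup M] [Module (MvPolynomial σ K) M] {d : ℕ∞}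
    (hM : idealOfVars σ K • (⊤ : Submodule (MvPolynomial σ K) M) ≠ ⊤)
    (h : ∀ rs : List (MvPolynomial σ K), (∀ f ∈ rs, f ∈ idealOfVars σ K) →
      RingTheory.Sequence.IsWeaklyRegular M rs → (rs.length : ℕ∞) ≤ d) :
    depth σ K M ≤ d := by
  rw [depth, if_neg hM]
  exact iSup₂_le fun rs hrs => h rs hrs.1 hrs.2.toIsWeaklyRegular

lemma koszulVanishes_of_isWeaklyRegular {σ : Type*} [Fintype σ] [DecidableEq σ] {M : Type*}
    [AddCommGroup M] [Module (MvPolynomial σ K) M] {rs : List (MvPolynomial σ K)}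
    (hrs : ∀ f ∈ rs, f ∈ idealOfVars σ K) (hr : RingTheory.Sequence.IsWeaklyRegular M rs)
    (F : Finset σ) {i : ℕ} (hi : i < rs.length) : KoszulVanishes (squaredVars K F) M i :=
  KoszulVanishes.of_isWeaklyRegular hr
    (fun f hf => idealOfVars_le_radical_squaredVars F (hrs f hf)) hi

/-- A weakly regular sequence of polynomials without constant term is at most as long as the number
of variables. -/
lemma length_le_card_of_isWeaklyRegular {σ : Type*} [Fintype σ] [DecidableEq σ]
    {rs : List (MvPolynomial σ K)} (hrs : ∀ f ∈ rs, f ∈ idealOfVars σ K)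
    (hr : RingTheory.Sequence.IsWeaklyRegular (MvPolynomial σ K) rs) :
    rs.length ≤ Fintype.card σ := by
  by_contra hlt
  -- S is the Stanley–Reisner ring of the full simplex, whose facet is the set of all vertices.
  have hG : ¬ upperFamily (∅ : Set (Finset σ)) Finset.univ := by simp [upperFamily]
  have hr' := ((Submodule.quotEquivOfEqBot _ (sqfIdeal_eq_bot (K := K)
    hG)).symm.isWeaklyRegular_congr rs).mp hr
  exact not_koszulVanishes_of_facet hG (fun v hv => absurd (Finset.mem_univ v) hv)
    (koszulVanishes_of_isWeaklyRegular hrs hr' Finset.univ (not_le.mp hlt))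

lemma length_le_sdepth_of_isWeaklyRegular_ideal {G : Set (Finset (Fin 5))}
    (huniv : upperFamily G Finset.univ) {rs : List (MvPolynomial (Fin 5) K)}
    (hrs : ∀ f ∈ rs, f ∈ idealOfVars (Fin 5) K)
    (hr : RingTheory.Sequence.IsWeaklyRegular (sqfIdeal K G) rs) :
    (rs.length : ℕ∞) ≤ sdepth (sqfIdeal K G) := by
  by_cases h0 : upperFamily G ∅
  · refine le_trans ?_ (five_le_sdepth h0)
    rw [sqfIdeal_eq_top h0] at hr
    have := length_le_card_of_isWeaklyRegular hrs
      ((Submodule.topEquiv.isWeaklyRegular_congr rs).mp hr)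
    rw [Fintype.card_fin] at this
    exact_mod_cast this
  · rcases hn : rs.length with _ | t
    · simp
    -- The vanishing for S is available only below degree five, whence the minimum; `h4` later shows
    -- that it equals `t`.
    · have hv : ∀ F : Finset (Fin 5), ∀ i < min t 5,
          KoszulVanishes (squaredVars K F) (MvPolynomial (Fin 5) K ⧸ sqfIdeal K G) i := by
        intro F i hi
        rw [lt_min_iff] at hi
        exact (koszulVanishes_mvPolynomial (idealOfVars_le_radical_squaredVars F)
          (by simpa using hi.2)).quotient _
          (koszulVanishes_of_isWeaklyRegular hrs hr F (by omega))
      obtain ⟨h4, hle⟩ := le_sdepth_of_koszulVanishes h0 huniv hv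
      rwa [show min t 5 = t by omega] at hle

lemma length_succ_le_sdepth_of_isWeaklyRegular_quotient {G : Set (Finset (Fin 5))}
    (h0 : ¬ upperFamily G ∅) (huniv : upperFamily G Finset.univ)
    {rs : List (MvPolynomial (Fin 5) K)} (hrs : ∀ f ∈ rs, f ∈ idealOfVars (Fin 5) K)
    (hr : RingTheory.Sequence.IsWeaklyRegular (MvPolynomial (Fin 5) K ⧸ sqfIdeal K G) rs) :
    ((rs.length + 1 : ℕ) : ℕ∞) ≤ sdepth (sqfIdeal K G) :=
  (le_sdepth_of_koszulVanishes h0 huniv fun F _ hi =>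
    koszulVanishes_of_isWeaklyRegular hrs hr F hi).2

end StanleyDepth

theorem theorem5 {K : Type*} [Field K] (I : Ideal (MvPolynomial (Fin 5) K))
    (hI : StanleyDepth.IsSquarefreeMonomialIdeal I) :
    StanleyDepth.depth (Fin 5) K I ≤ StanleyDepth.sdepth I ∧
      (I ≠ ⊤ →
        1 + StanleyDepth.depth (Fin 5) K (MvPolynomial (Fin 5) K ⧸ I) ≤
          StanleyDepth.sdepth I) := by
  obtain ⟨G, hG⟩ := hI
  obtain rfl : I = StanleyDepth.sqfIdeal K G := hG
  by_cases huniv : StanleyDepth.upperFamily G Finset.univ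
  · have hne : StanleyDepth.sqfIdeal K G ≠ ⊥ := by
      intro hbot
      have h1 : MvPolynomial.monomial (StanleyDepth.sqfExp Finset.univ) (1 : K) ∈
          StanleyDepth.sqfIdeal K G := StanleyDepth.monomial_mem_sqfIdeal (by simpa using huniv)
      simp [hbot] at h1
    refine ⟨StanleyDepth.depth_le (StanleyDepth.idealOfVars_smul_ideal_ne_top hne)
      fun rs hrs hr => StanleyDepth.length_le_sdepth_of_isWeaklyRegular_ideal huniv hrs hr,
      fun htop => ?_⟩
    have h0 : ¬ StanleyDepth.upperFamily G ∅ := fun h => htop (StanleyDepth.sqfIdeal_eq_top h)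
    have key : ∀ rs : List (MvPolynomial (Fin 5) K),
        (∀ f ∈ rs, f ∈ MvPolynomial.idealOfVars (Fin 5) K) →
        RingTheory.Sequence.IsWeaklyRegular
          (MvPolynomial (Fin 5) K ⧸ StanleyDepth.sqfIdeal K G) rs →
        1 + (rs.length : ℕ∞) ≤ StanleyDepth.sdepth (StanleyDepth.sqfIdeal K G) := by
      intro rs hrs hr
      have := StanleyDepth.length_succ_le_sdepth_of_isWeaklyRegular_quotient h0 huniv hrs hr
      rwa [Nat.cast_add, Nat.cast_one, add_comm] at this
    -- The empty sequence gives 1 ≤ sdepth, so the truncated subtraction of 1 is exact.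
    have h1 := le_trans le_self_add
      (key [] (by simp) (RingTheory.Sequence.IsWeaklyRegular.nil _ _))
    rw [← add_tsub_cancel_of_le h1]
    gcongr
    exact StanleyDepth.depth_le (StanleyDepth.idealOfVars_smul_quotient_ne_top h0)
      fun rs hrs hr => ENat.le_sub_of_add_le_left ENat.one_ne_top (key rs hrs hr)
  · rw [StanleyDepth.sdepth_eq_top huniv]
    exact ⟨le_top, fun _ => le_top⟩
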